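/- For a metric space $(X,d)$, call $S\subseteq X$ $r$-separated if $d(x,y)\ge r$ for all distinct $x,y\in S$, and let $N_r(A)$ be the maximal cardinality of an $r$-separated subset of $A$. Write $|A|$ for the diameter of $A$, $B(x,R)$ for the closed ball, and $\dim_{\mathrm H}$ for Hausdorff dimension. Let $\overline{\dim}_{\mathrm B}A=\limsup_{r\to0}\frac{\log N_r(A)}{-\log r}$, let the packing dimension be $\dim_{\mathrm P}A=\inf\{\sup_i\overline{\dim}_{\mathrm B}A_i : A=\bigcup_{i\in\mathbb N}A_i\}$, and let the lower dimension $\dim_{\mathrm L}A$ be the supremum of all $s\ge0$ for which there is $C>0$ with $N_r(B(x,R)\cap A)\ge C(R/r)^s$ for all $0<r<R\le|A|$ and all $x\in A$. A choice of abstract rationals in a nonempty totally bounded set $F$ is a family $(P(q))_{q\ge1}$ in which each $P(q)$ is a maximal $(1/q)$-separated subset of $F$; given such a choice and $t>0$, let $F_t$ be the set of $x\in F$ such that, for infinitely many $q$, there is $p\in P(q)$ with $d(p,x)\le q^{-t}$. **Proposition.** For all real numbers $0\le L\le H\le1$ there exists a nonempty compact set $F\subseteq[0,1]$ with $$\dim_{\mathrm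 L}F=L,\qquad \dim_{\mathrm H}F=\dim_{\mathrm P}F=H,$$ and a choice of abstract rationals in $F$ such that, for all $t>1$, $$\dim_{\mathrm H}F_t=\frac Lt=\frac{\dim_{\mathrm L}F}{t}.$$ -/

import Mathlib

open Set Filter Topology
open scoped ENNReal NNReal

/-- A subset `S` of a metric space is `r`-separated if any two distinct points of `S` are at
distance at least `r`. -/
def IsSeparatedSet {X : Type*} [MetricSpace X] (r : ℝ) (S : Set X) : Prop :=
  S.Pairwise fun x y => r ≤ dist x y

/-- `N_r(A)`: the largest cardinality of an `r`-separated subset of `A`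
(`⊤` if these cardinalities are unbounded). -/
noncomputable def sepNumber {X : Type*} [MetricSpace X] (r : ℝ) (A : Set X) : ℕ∞ :=
  ⨆ (S : Set X) (_ : S ⊆ A ∧ IsSeparatedSet r S), S.encard

/-- The upper box dimension `limsup_{r → 0} log N_r(A) / (- log r)`. The `limsup` is taken in the
extended reals; it is nonnegative for nonempty `A`, and `toENNReal` only serves to give
the empty set dimension `0`, as is done for the Hausdorff dimension `dimH`. -/
noncomputable def upperBoxDim {X : Type*} [MetricSpace X] (A : Set X) : ℝ≥0∞ :=
  (limsup (fun r : ℝ => ENNReal.log (sepNumber r A : ℝ≥0∞) / ((-Real.log r : ℝ) : EReal))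
    (𝓝[>] (0 : ℝ))).toENNReal

/-- The packing dimension: the infimum, over countable decompositions `A = ⋃ i, c i`, of
`sup_i` of the upper box dimensions of the pieces. -/
noncomputable def packingDim {X : Type*} [MetricSpace X] (A : Set X) : ℝ≥0∞ :=
  ⨅ (c : ℕ → Set X) (_ : A = ⋃ i, c i), ⨆ i, upperBoxDim (c i)

/-- The lower dimension: the supremum of the `s ≥ 0` for which there is `C > 0` such that
`N_r(B(x,R) ∩ A) ≥ C (R/r)^s` for all `0 < r < R ≤ |A|` and all `x ∈ A`,
where `|A|` is the diameter of `A` and `B(x,R)` is a closed ball. -/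
noncomputable def lowerDim {X : Type*} [MetricSpace X] (A : Set X) : ℝ≥0∞ :=
  ⨆ (s : ℝ≥0) (_ : ∃ C : ℝ, 0 < C ∧ ∀ r R : ℝ, 0 < r → r < R →
      ENNReal.ofReal R ≤ Metric.ediam A → ∀ x ∈ A,
        ENNReal.ofReal (C * (R / r) ^ (s : ℝ)) ≤
          (sepNumber r (Metric.closedBall x R ∩ A) : ℝ≥0∞)),
    (s : ℝ≥0∞)

/-- `P` is a choice of abstract rationals in `F`: for each integer `q ≥ 1`, `P q` is a maximal
`(1/q)`-separated subset of `F`. (The value `P 0` plays no role.) -/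
def IsAbstractRationals {X : Type*} [MetricSpace X] (F : Set X) (P : ℕ → Set X) : Prop :=
  ∀ q : ℕ, 1 ≤ q → Maximal (fun S : Set X => S ⊆ F ∧ IsSeparatedSet (1 / (q : ℝ)) S) (P q)

/-- `F_t`: the points `x ∈ F` such that for infinitely many `q` there is `p ∈ P q` with
`d(p, x) ≤ 1 / q ^ t`. -/
def approxSet {X : Type*} [MetricSpace X] (F : Set X) (P : ℕ → Set X) (t : ℝ) : Set X :=
  {x | x ∈ F ∧ ∀ N : ℕ, ∃ q : ℕ, N < q ∧ ∃ p ∈ P q, dist p x ≤ 1 / (q : ℝ) ^ t}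

/-! The set `F` is `pointSet G' G`, described by binary digits. The digits that may be one form sets
`G' ⊆ G` of densities `L ≤ H`, together with the sparse positions `2k²`. A one at `2k²` is an
escape: from then on only digits in `G'` may be one. Codes that never escape form a main part of
dimension `H`. Codes that escape at a given position form a piece of dimension at most `L`, and
there are countably many pieces, so Hausdorff and packing dimension are both `H`. At every point and
every scale the digits in `G'` may be altered freely, so the lower dimension is at least `L`. Near
`1/2` only codes escaping at position `0` occur, so it is at most `L`.

The abstract rationals are hidden in the escaped pieces. At scale `2^(-2k²)` every point has a
neighbour in `F` that agrees with it before `2k²`, escapes at `2k²` at the latest, and has all later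
digits of `G'` equal to one (`upperCode`). It is the largest such code, so it lies to the right of
the point at distance less than the scale, and a greedy sweep from left to right selects a maximal
separated set of such neighbours (`exists_separated_cover`).

The digit at `2k²+1` is always zero. This creates gaps: a rational at scale `k` stays at distance
about `2^(-2k²)` from any code that has not escaped by `2k²`. Since `t > 1` and consecutive scales
have comparable exponents, such a code cannot be approximated infinitely often (`approxSet_subset`).
In a fixed escaped piece there are only about `2^(2Lk²)` rationals at scale `k`, each approximating
within about `2^(-2tk²)`, which gives `dimH F_t ≤ L/t` (`dimH_nearSet_le`).

For the lower bound, at `q = 2^(2k²)` all candidates with first digit one are mutually separated and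
are kept as rationals. A code whose digits on `G'` are forced to be one on very sparse windows `[m,
tm)`, with `m = 2k²`, agrees with a rational up to position `tm`, and the remaining free positions
have lower density `L/t` (`le_card_sparseBits`, `mem_approxSet_of_sparseBits`). -/

/-! ### Binary codes -/

/-- The integer whose binary digits are the first `n` digits of `d`. -/
def prefixNat (d : ℕ → Fin 2) : ℕ → ℕ
  | 0 => 0
  | n + 1 => 2 * prefixNat d n + d n

theorem prefixNat_congr {d e : ℕ → Fin 2} {n : ℕ} (h : ∀ i < n, d i = e i) :
    prefixNat d n = prefixNat e n := by
  induction n with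
  | zero => rfl
  | succ n ih =>
    simp only [prefixNat]
    rw [ih fun i hi => h i (by omega), h n (by omega)]

theorem eq_of_prefixNat_eq {d e : ℕ → Fin 2} {n : ℕ} (h : prefixNat d n = prefixNat e n) :
    ∀ i < n, d i = e i := by
  induction n with
  | zero => intro i hi; omega
  | succ n ih =>
    simp only [prefixNat] at h
    have h1 := (d n).isLt
    have h2 := (e n).isLt
    intro i hi
    rcases Nat.lt_succ_iff_lt_or_eq.1 hi with hi | rfl
    · exact ih (by omega) i hi
    · exact Fin.ext (by omega)

theorem two_pow_mul_ofDigits (d : ℕ → Fin 2) (n : ℕ) :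
    2 ^ n * Real.ofDigits d = prefixNat d n + Real.ofDigits (fun i => d (i + n)) := by
  induction n with
  | zero => simp [prefixNat]
  | succ n ih =>
    have h := Real.ofDigits_eq_sum_add_ofDigits (fun i => d (i + n)) 1
    simp only [Finset.range_one, Finset.sum_singleton, Real.ofDigitsTerm] at h
    have h' : (fun i => d (i + 1 + n)) = fun i => d (i + (n + 1)) := by
      funext i; congr 1; ring
    rw [h'] at h
    rw [pow_succ', mul_assoc, ih, h]
    simp only [prefixNat]
    push_cast
    simp
    ring

theorem ofDigits_le_half {d : ℕ → Fin 2} (h : d 0 = 0) : Real.ofDigits d ≤ 1 / 2 := by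
  have h1 := two_pow_mul_ofDigits d 1
  have h2 := Real.ofDigits_le_one (fun i => d (i + 1))
  simp [prefixNat, h] at h1
  linarith

theorem ofDigits_mono {d e : ℕ → Fin 2} (h : ∀ i, d i = 1 → e i = 1) :
    Real.ofDigits d ≤ Real.ofDigits e := by
  refine Summable.tsum_le_tsum (fun i => ?_) Real.summable_ofDigitsTerm
    Real.summable_ofDigitsTerm
  unfold Real.ofDigitsTerm
  gcongr
  have h1 := h i
  generalize d i = a at *
  generalize e i = b at *
  revert h1
  revert a b
  decide

/-- Codes are ordered lexicographically. -/
theorem ofDigits_le_of_lex {d e : ℕ → Fin 2} {i : ℕ} (h : ∀ j < i, d j = e j)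
    (hd : d i = 0) (he : e i = 1) : Real.ofDigits d ≤ Real.ofDigits e := by
  have h1 := two_pow_mul_ofDigits d (i + 1)
  have h2 := two_pow_mul_ofDigits e (i + 1)
  have h3 := Real.ofDigits_le_one (fun j => d (j + (i + 1)))
  have h4 := Real.ofDigits_nonneg (fun j => e (j + (i + 1)))
  simp only [prefixNat, hd, he, prefixNat_congr h] at h1 h2
  have h5 : (0 : ℝ) < 2 ^ (i + 1) := by positivity
  refine le_of_mul_le_mul_left ?_ h5
  rw [h1, h2]
  push_cast
  simp
  linarith

theorem abs_ofDigits_sub_le {d e : ℕ → Fin 2} {n : ℕ} (h : ∀ i < n, d i = e i) :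
    |Real.ofDigits d - Real.ofDigits e| ≤ (1 / 2) ^ n := by
  have := Real.abs_ofDigits_sub_ofDigits_le h
  simpa using this

theorem one_le_abs_sub_of_ne {a b : ℕ} (h : a ≠ b) : (1 : ℝ) ≤ |(a : ℝ) - b| := by
  have h1 : (1 : ℤ) ≤ |(a : ℤ) - b| := Int.one_le_abs (by omega)
  exact_mod_cast h1

/-- Points whose codes have the same tail are far apart. -/
theorem le_abs_ofDigits_sub_of_tail {d e : ℕ → Fin 2} {n : ℕ} (h : ∀ i, n ≤ i → d i = e i)
    (hne : Real.ofDigits d ≠ Real.ofDigits e) :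
    (1 / 2) ^ n ≤ |Real.ofDigits d - Real.ofDigits e| := by
  have h1 := two_pow_mul_ofDigits d n
  have h2 := two_pow_mul_ofDigits e n
  have h3 : (fun i => d (i + n)) = fun i => e (i + n) := by
    funext i; exact h _ (by omega)
  rw [h3] at h1
  have h5 : (0 : ℝ) < 2 ^ n := by positivity
  have h4 : prefixNat d n ≠ prefixNat e n := by
    intro h4
    rw [h4, ← h2] at h1
    exact hne (mul_left_cancel₀ h5.ne' h1)
  have h6 := one_le_abs_sub_of_ne h4
  have h7 : (prefixNat d n : ℝ) - prefixNat e n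
      = 2 ^ n * (Real.ofDigits d - Real.ofDigits e) := by
    linarith
  rw [h7, abs_mul, abs_of_pos h5] at h6
  rw [one_div, inv_pow]
  exact (inv_le_iff_one_le_mul₀' h5).2 h6

/-- Points whose codes differ before a common zero are far apart. -/
theorem le_abs_ofDigits_sub_of_zero {d e : ℕ → Fin 2} {i n : ℕ} (hi : i < n) (hne : d i ≠ e i)
    (hd : d n = 0) (he : e n = 0) :
    (1 / 2) ^ (n + 1) ≤ |Real.ofDigits d - Real.ofDigits e| := by
  have h1 := two_pow_mul_ofDigits d n
  have h2 := two_pow_mul_ofDigits e n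
  have h4 : prefixNat d n ≠ prefixNat e n := fun h => hne (eq_of_prefixNat_eq h i hi)
  have h6 := one_le_abs_sub_of_ne h4
  have a1 := Real.ofDigits_nonneg (fun i => d (i + n))
  have a2 := Real.ofDigits_nonneg (fun i => e (i + n))
  have a3 : Real.ofDigits (fun i => d (i + n)) ≤ 1 / 2 := ofDigits_le_half (by simpa using hd)
  have a4 : Real.ofDigits (fun i => e (i + n)) ≤ 1 / 2 := ofDigits_le_half (by simpa using he)
  have h5 : (0 : ℝ) < 2 ^ n := by positivity
  -- The integer prefixes differ by at least one, while the zero at `n` confines both tails to `[0,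
  -- 1/2]`.
  have h8 : (1 / 2 : ℝ) ≤ |2 ^ n * (Real.ofDigits d - Real.ofDigits e)| := by
    have h7 : (prefixNat d n : ℝ) - prefixNat e n
        = 2 ^ n * (Real.ofDigits d - Real.ofDigits e) +
          (Real.ofDigits (fun i => e (i + n)) - Real.ofDigits (fun i => d (i + n))) := by
      linarith
    rw [h7] at h6
    have h9 := h6.trans (abs_add_le _ _)
    have h10 : |Real.ofDigits (fun i => e (i + n)) - Real.ofDigits (fun i => d (i + n))| ≤ 1 / 2 :=
      abs_le.2 ⟨by linarith, by linarith⟩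
    linarith
  rw [abs_mul, abs_of_pos h5] at h8
  rw [pow_succ, one_div, inv_pow, mul_inv_le_iff₀ (by norm_num), inv_le_iff_one_le_mul₀' h5]
  linarith

theorem fin_two_eq_zero {a : Fin 2} (h : a ≠ 1) : a = 0 := by
  revert a; decide

/-! ### Counting free positions -/

open Classical in
/-- The positions of `T` in `[a, b)`. -/
noncomputable def bitsIn (T : Set ℕ) (a b : ℕ) : Finset ℕ := (Finset.Ico a b).filter (· ∈ T)

theorem mem_bitsIn {T : Set ℕ} {a b i : ℕ} : i ∈ bitsIn T a b ↔ (a ≤ i ∧ i < b) ∧ i ∈ T := by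
  simp [bitsIn]

theorem bitsIn_succ_of_mem {T : Set ℕ} {a b : ℕ} (h : a ≤ b) (hb : b ∈ T) :
    (bitsIn T a (b + 1)).card = (bitsIn T a b).card + 1 := by
  have : bitsIn T a (b + 1) = insert b (bitsIn T a b) := by
    ext i
    simp only [mem_bitsIn, Finset.mem_insert]
    constructor
    · rintro ⟨⟨h1, h2⟩, h3⟩
      by_cases h4 : i = b
      · exact Or.inl h4
      · exact Or.inr ⟨⟨h1, by omega⟩, h3⟩
    · rintro (rfl | ⟨⟨h1, h2⟩, h3⟩)
      · exact ⟨⟨h, by omega⟩, hb⟩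
      · exact ⟨⟨h1, by omega⟩, h3⟩
  rw [this, Finset.card_insert_of_notMem (by simp [mem_bitsIn])]

theorem bitsIn_succ_of_notMem {T : Set ℕ} {a b : ℕ} (hb : b ∉ T) :
    bitsIn T a (b + 1) = bitsIn T a b := by
  ext i
  simp only [mem_bitsIn]
  constructor
  · rintro ⟨⟨h1, h2⟩, h3⟩
    have : i ≠ b := fun h => hb (h ▸ h3)
    exact ⟨⟨h1, by omega⟩, h3⟩
  · rintro ⟨⟨h1, h2⟩, h3⟩
    exact ⟨⟨h1, by omega⟩, h3⟩

theorem bitsIn_self (T : Set ℕ) (a : ℕ) : bitsIn T a a = ∅ := by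
  simp [bitsIn]

/-- The increments of a monotone integer sequence with steps at most one count themselves. -/
theorem card_bitsIn_increments {h : ℕ → ℕ} (hm : Monotone h) (h1 : ∀ n, h (n + 1) ≤ h n + 1)
    {a b : ℕ} (hab : a ≤ b) :
    (bitsIn {n | h n < h (n + 1)} a b).card + h a = h b := by
  induction b, hab using Nat.le_induction with
  | base => simp [bitsIn_self]
  | succ b hb ih =>
    have h2 := h1 b
    have h3 := hm (Nat.le_succ b)
    by_cases hlt : h b < h (b + 1)
    · rw [bitsIn_succ_of_mem hb hlt]; omega
    · rw [bitsIn_succ_of_notMem (by simpa using hlt)]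
      simp only [Nat.succ_eq_add_one] at *
      omega

/-- There are few numbers of the form `2k² + δ` in an interval. -/
theorem card_bitsIn_squares (δ a b : ℕ) :
    (bitsIn {n | ∃ k, n = 2 * k ^ 2 + δ} a b).card ≤ Nat.sqrt (b - a) + 1 := by
  have hex : ∃ k, a ≤ 2 * k ^ 2 + δ := ⟨a, by nlinarith [Nat.zero_le δ]⟩
  classical
  set k₀ := Nat.find hex with hk₀
  have hs : bitsIn {n | ∃ k, n = 2 * k ^ 2 + δ} a b ⊆
      (Finset.range (Nat.sqrt (b - a) + 1)).image fun l => 2 * (k₀ + l) ^ 2 + δ := by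
    intro n hn
    obtain ⟨⟨h1, h2⟩, k, rfl⟩ := mem_bitsIn.1 hn
    have hk : k₀ ≤ k := Nat.find_min' hex h1
    obtain ⟨l, rfl⟩ := Nat.exists_eq_add_of_le hk
    refine Finset.mem_image.2 ⟨l, ?_, rfl⟩
    rw [Finset.mem_range, Nat.lt_succ_iff, Nat.le_sqrt]
    have h3 : a ≤ 2 * k₀ ^ 2 + δ := Nat.find_spec hex
    -- Since `2(k₀ + l)² ≥ 2k₀² + 2l²`, the offset `l` is at most the square root of the length.
    have : a + l * l ≤ b := by nlinarith
    omega
  exact (Finset.card_le_card hs).trans (Finset.card_image_le.trans (by simp))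

theorem nat_sqrt_le_mul_add {ε : ℝ} (hε : 0 < ε) (n : ℕ) : (Nat.sqrt n : ℝ) ≤ ε * n + 1 / ε := by
  have h1 : (Nat.sqrt n : ℝ) * Nat.sqrt n ≤ n := by exact_mod_cast Nat.sqrt_le n
  generalize (Nat.sqrt n : ℝ) = x at *
  have h2 : ε * (x * x) ≤ ε * n := by gcongr
  have h3 : x ≤ ε * (x * x) + 1 / ε := by
    rw [← sub_nonneg]
    have : ε * (x * x) + 1 / ε - x = (ε * x - 1 / 2) ^ 2 / ε + 3 / (4 * ε) := by
      field_simp; ring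
    rw [this]; positivity
  linarith

/-- Nested sets of free positions of densities `L` and `H`, avoiding `2k²` and `2k² + 1`. -/
structure IsBitPattern (L H : ℝ) (G' G : Set ℕ) : Prop where
  subset : G' ⊆ G
  notMem : ∀ k, 2 * k ^ 2 ∉ G
  succ_notMem : ∀ k, 2 * k ^ 2 + 1 ∉ G
  card_le : ∀ n, ((bitsIn G 0 n).card : ℝ) ≤ H * n
  card_le' : ∀ n, ((bitsIn G' 0 n).card : ℝ) ≤ L * n
  le_card : ∀ ε, 0 < ε → ∃ C, ∀ a b, a ≤ b → (H - ε) * (b - a) - C ≤ (bitsIn G a b).card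
  le_card' : ∀ ε, 0 < ε → ∃ C, ∀ a b, a ≤ b → (L - ε) * (b - a) - C ≤ (bitsIn G' a b).card

theorem bitsIn_mono {S T : Set ℕ} (h : S ⊆ T) {a b a' b' : ℕ} (ha : a' ≤ a) (hb : b ≤ b') :
    bitsIn S a b ⊆ bitsIn T a' b' := by
  intro i hi
  rw [mem_bitsIn] at *
  exact ⟨⟨by omega, by omega⟩, h hi.2⟩

/-- The positions removed from an interval are of the order of the square root of its length, hence
cost nothing in density, uniformly over intervals. -/
theorem card_bitsIn_diff_squares (A : Set ℕ) {ε : ℝ} (hε : 0 < ε) :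
    ∃ C : ℝ, ∀ a b, a ≤ b → ((bitsIn A a b).card : ℝ) - ε * (b - a) - C ≤
      (bitsIn (A \ ({n | ∃ k, n = 2 * k ^ 2 + 0} ∪ {n | ∃ k, n = 2 * k ^ 2 + 1})) a b).card := by
  refine ⟨2 * (1 / (ε / 2) + 1), fun a b hab => ?_⟩
  set S₀ := {n | ∃ k, n = 2 * k ^ 2 + 0}
  set S₁ := {n | ∃ k, n = 2 * k ^ 2 + 1}
  classical
  have hs : bitsIn A a b ⊆ bitsIn (A \ (S₀ ∪ S₁)) a b ∪ (bitsIn S₀ a b ∪ bitsIn S₁ a b) := by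
    intro i hi
    simp only [Finset.mem_union, mem_bitsIn, Set.mem_sdiff, Set.mem_union] at *
    tauto
  have h1 := (Finset.card_le_card hs).trans ((Finset.card_union_le _ _).trans
    (Nat.add_le_add_left (Finset.card_union_le _ _) _))
  have h2 : (bitsIn S₀ a b).card ≤ _ := card_bitsIn_squares 0 a b
  have h3 : (bitsIn S₁ a b).card ≤ _ := card_bitsIn_squares 1 a b
  have h4 := nat_sqrt_le_mul_add (half_pos hε) (b - a)
  have h5 : (bitsIn A a b).card ≤
      (bitsIn (A \ (S₀ ∪ S₁)) a b).card + (2 * Nat.sqrt (b - a) + 2) := by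
    omega
  have h6 : ((bitsIn A a b).card : ℝ) ≤
      (bitsIn (A \ (S₀ ∪ S₁)) a b).card + (2 * Nat.sqrt (b - a) + 2) := by exact_mod_cast h5
  rw [Nat.cast_sub hab] at h4
  linarith

/-- The jump times of `f n = ⌊H n⌋` have density `H` with bounded error on every interval. Taking `g
= ⌊(L/H) f⌋`, a function of `f` rather than of `n`, makes `g` jump only where `f` does, which gives
the nesting. For `H = 0` the convention `L / 0 = 0` is harmless. -/
theorem exists_isBitPattern {L H : ℝ} (hL : 0 ≤ L) (hLH : L ≤ H) (hH : H ≤ 1) :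
    ∃ G' G, IsBitPattern L H G' G := by
  have hH0 : 0 ≤ H := hL.trans hLH
  set l := L / H with hl
  have hl0 : 0 ≤ l := div_nonneg hL hH0
  have hl1 : l ≤ 1 := div_le_one_of_le₀ hLH hH0
  have hlH : l * H = L := by
    rcases hH0.eq_or_lt with h | h
    · rw [← h, mul_zero]; linarith
    · rw [hl, div_mul_cancel₀ _ h.ne']
  set f : ℕ → ℕ := fun n => ⌊H * n⌋₊ with hf
  set g : ℕ → ℕ := fun n => ⌊l * f n⌋₊ with hg
  have fm : Monotone f := fun a b hab => Nat.floor_mono (by gcongr)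
  have gm : Monotone g := fun a b hab => by
    have := fm hab
    exact Nat.floor_mono (by gcongr)
  have f1 : ∀ n, f (n + 1) ≤ f n + 1 := fun n => by
    rw [hf]
    simp only
    rw [← Nat.floor_add_one (by positivity)]
    refine Nat.floor_mono ?_
    push_cast; linarith
  have g1 : ∀ n, g (n + 1) ≤ g n + 1 := fun n => by
    rw [hg]
    simp only
    rw [← Nat.floor_add_one (by positivity)]
    refine Nat.floor_mono ?_
    have : (f (n + 1) : ℝ) ≤ f n + 1 := by exact_mod_cast f1 n
    nlinarith
  have flo : ∀ n : ℕ, (f n : ℝ) ≤ H * n := fun n => Nat.floor_le (by positivity)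
  have fhi : ∀ n : ℕ, H * n - 1 ≤ (f n : ℝ) := fun n => by
    have := Nat.lt_floor_add_one (H * n); simp only [hf]; linarith
  have glo : ∀ n : ℕ, (g n : ℝ) ≤ L * n := fun n => by
    have h1 : (g n : ℝ) ≤ l * f n := Nat.floor_le (by positivity)
    have h2 := mul_le_mul_of_nonneg_left (flo n) hl0
    rw [← hlH]; linarith
  have ghi : ∀ n : ℕ, L * n - 2 ≤ (g n : ℝ) := fun n => by
    have h1 := Nat.lt_floor_add_one (l * f n)
    have h2 := mul_le_mul_of_nonneg_left (fhi n) hl0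
    rw [← hlH]; simp only [hg]; linarith
  have zero_le_card : ∀ {h : ℕ → ℕ} {c : ℝ}, Monotone h → (∀ n, h (n + 1) ≤ h n + 1) →
      (∀ n : ℕ, (h n : ℝ) ≤ c * n) → ∀ n : ℕ,
      ((bitsIn ({n | h n < h (n + 1)} \ ({n | ∃ k, n = 2 * k ^ 2 + 0} ∪
        {n | ∃ k, n = 2 * k ^ 2 + 1})) 0 n).card : ℝ) ≤ c * n := by
    intro h c hm h1 h2 n
    have h3 := card_bitsIn_increments hm h1 (Nat.zero_le n)
    have h4 := Finset.card_le_card (bitsIn_mono (sdiff_subset (s := {n | h n < h (n + 1)})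
      (t := {n | ∃ k, n = 2 * k ^ 2 + 0} ∪ {n | ∃ k, n = 2 * k ^ 2 + 1})) (le_refl 0) (le_refl n))
    refine le_trans ?_ (h2 n)
    exact_mod_cast by omega
  have le_card_aux : ∀ {h : ℕ → ℕ} {c : ℝ}, Monotone h → (∀ n, h (n + 1) ≤ h n + 1) →
      (∀ n : ℕ, (h n : ℝ) ≤ c * n) → (∀ n : ℕ, c * n - 2 ≤ (h n : ℝ)) → ∀ ε : ℝ, 0 < ε → ∃ C : ℝ,
      ∀ a b : ℕ, a ≤ b → (c - ε) * (b - a) - C ≤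
      (bitsIn ({n | h n < h (n + 1)} \ ({n | ∃ k, n = 2 * k ^ 2 + 0} ∪
        {n | ∃ k, n = 2 * k ^ 2 + 1})) a b).card := by
    intro h c hm h1 h2 h3 ε hε
    obtain ⟨C, hC⟩ := card_bitsIn_diff_squares {n | h n < h (n + 1)} hε
    refine ⟨C + 2, fun a b hab => ?_⟩
    have h4 : ((bitsIn {n | h n < h (n + 1)} a b).card : ℝ) + h a = h b := by
      exact_mod_cast card_bitsIn_increments hm h1 hab
    have h5 := hC a b hab
    have h6 := h2 a
    have h7 := h3 b
    nlinarith
  refine ⟨{n | g n < g (n + 1)} \ ({n | ∃ k, n = 2 * k ^ 2 + 0} ∪ {n | ∃ k, n = 2 * k ^ 2 + 1}),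
    {n | f n < f (n + 1)} \ ({n | ∃ k, n = 2 * k ^ 2 + 0} ∪ {n | ∃ k, n = 2 * k ^ 2 + 1}),
    ?_, ?_, ?_, ?_, ?_, ?_, ?_⟩
  · refine sdiff_subset_sdiff_left fun n hn => ?_
    by_contra h
    have h1 : f (n + 1) = f n := le_antisymm (not_lt.1 h) (fm (Nat.le_succ n))
    simp only [mem_ofPred_eq, hg, h1, lt_self_iff_false] at hn
  · exact fun k hk => hk.2 (Or.inl ⟨k, rfl⟩)
  · exact fun k hk => hk.2 (Or.inr ⟨k, rfl⟩)
  · exact zero_le_card fm f1 flo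
  · exact zero_le_card gm g1 glo
  · exact le_card_aux fm f1 flo fun n => by linarith [fhi n]
  · exact le_card_aux gm g1 glo ghi

/-! ### Dimensions -/

section Dimension

open MeasureTheory Measure

theorem exists_isSeparatedSet_encard_eq {X : Type*} [MetricSpace X] {r : ℝ} {A : Set X}
    (h : sepNumber r A ≠ ⊤) :
    ∃ S : Set X, S ⊆ A ∧ IsSeparatedSet r S ∧ S.encard = sepNumber r A := by
  have : Nonempty {S : Set X // S ⊆ A ∧ IsSeparatedSet r S} :=
    ⟨⟨∅, empty_subset _, pairwise_empty _⟩⟩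
  unfold sepNumber at *
  rw [iSup_subtype'] at *
  obtain ⟨S, hS⟩ := ENat.exists_eq_iSup_of_lt_top (lt_top_iff_ne_top.2 h)
  exact ⟨S, S.2.1, S.2.2, hS⟩

theorem le_sepNumber {X : Type*} [MetricSpace X] {r : ℝ} {A S : Set X} (hS : S ⊆ A)
    (h : IsSeparatedSet r S) : S.encard ≤ sepNumber r A :=
  le_iSup₂_of_le S ⟨hS, h⟩ le_rfl

theorem sepNumber_mono {X : Type*} [MetricSpace X] {r : ℝ} {A B : Set X} (h : A ⊆ B) :
    sepNumber r A ≤ sepNumber r B :=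
  iSup₂_le fun _ hS => le_sepNumber (hS.1.trans h) hS.2

/-- A set with finite separation number has a finite cover by closed balls, centred at a
separated set of largest cardinality. -/
theorem exists_finset_cover {X : Type*} [MetricSpace X] {r : ℝ} (hr : 0 ≤ r) {A : Set X}
    (h : sepNumber r A ≠ ⊤) :
    ∃ S : Finset X, A ⊆ ⋃ x ∈ S, Metric.closedBall x r ∧ (S.card : ℕ∞) ≤ sepNumber r A := by
  obtain ⟨S, hSA, hS, hcard⟩ := exists_isSeparatedSet_encard_eq h
  have hfin : S.Finite := by
    rw [← encard_ne_top_iff, hcard]; exact h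
  refine ⟨hfin.toFinset, fun x hx => ?_, ?_⟩
  · by_contra hx'
    simp only [Finite.mem_toFinset, mem_iUnion, Metric.mem_closedBall, exists_prop, not_exists,
      not_and, not_le] at hx'
    have hxS : x ∉ S := fun hxS => by
      have := hx' x hxS
      rw [dist_self] at this
      linarith
    have h1 : IsSeparatedSet r (insert x S) := by
      refine hS.insert fun y hy _ => ?_
      have := hx' y hy
      exact ⟨this.le, by rw [dist_comm]; exact this.le⟩
    have h2 := le_sepNumber (insert_subset hx hSA) h1
    rw [← hcard, encard_insert_of_notMem hxS, ENat.add_one_le_iff (encard_ne_top_iff.2 hfin)] at h2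
    exact lt_irrefl _ h2
  · rw [← hfin.encard_eq_coe_toFinset_card, hcard]

theorem ediam_closedBall_le_two_mul {X : Type*} [MetricSpace X] {x : X} (r : ℝ) :
    Metric.ediam (Metric.closedBall x r) ≤ 2 * ENNReal.ofReal r := by
  refine Metric.ediam_le fun a ha b hb => ?_
  rw [two_mul]
  refine (edist_triangle_right a b x).trans (add_le_add ?_ ?_)
  · rw [edist_dist]; exact ENNReal.ofReal_le_ofReal ha
  · rw [edist_dist]; exact ENNReal.ofReal_le_ofReal hb

theorem sepNumber_le_rpow_of_log_div_lt {X : Type*} [MetricSpace X] {r : ℝ} {A : Set X} {s : ℝ}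
    (hr0 : 0 < r) (hr1 : r < 1)
    (h : ENNReal.log (sepNumber r A : ℝ≥0∞) / ((-Real.log r : ℝ) : EReal) < (s : EReal)) :
    (sepNumber r A : ℝ≥0∞) ≤ ENNReal.ofReal (r ^ (-s)) := by
  have hlog : 0 < -Real.log r := neg_pos.2 (Real.log_neg hr0 hr1)
  rw [EReal.div_lt_iff (by exact_mod_cast hlog) (EReal.coe_ne_top _), ← EReal.coe_mul] at h
  have h1 : s * -Real.log r = Real.log (r ^ (-s)) := by
    rw [Real.log_rpow hr0]; ring
  rw [h1, ← ENNReal.log_ofReal_of_pos (Real.rpow_pos_of_pos hr0 _),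
    ENNReal.log_lt_log_iff] at h
  exact h.le

/-- For `s` above the box dimension, at most `r^(-s)` balls of diameter at most `2r` cover `A` once
`r` is small, so the `s`-dimensional measure is at most `2^s`. -/
theorem dimH_le_upperBoxDim {X : Type*} [MetricSpace X] (A : Set X) :
    dimH A ≤ upperBoxDim A := by
  borelize X
  refine le_of_forall_gt fun s' hs' => ?_
  obtain ⟨s, hs, hss'⟩ := ENNReal.lt_iff_exists_nnreal_btwn.1 hs'
  refine lt_of_le_of_lt ?_ hss'
  have h1 : limsup (fun r : ℝ => ENNReal.log (sepNumber r A : ℝ≥0∞) /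
      ((-Real.log r : ℝ) : EReal)) (𝓝[>] (0 : ℝ)) < ((s : ℝ) : EReal) := by
    by_contra h'
    have := EReal.toENNReal_le_toENNReal (not_lt.1 h')
    rw [EReal.real_coe_toENNReal, ENNReal.ofReal_coe_nnreal] at this
    exact absurd hs (not_lt.2 this)
  have h01 : ∀ᶠ r : ℝ in 𝓝[>] 0, 0 < r ∧ r < 1 := Ioo_mem_nhdsGT one_pos
  have h2 : ∀ᶠ r : ℝ in 𝓝[>] 0, (sepNumber r A : ℝ≥0∞) ≤ ENNReal.ofReal (r ^ (-(s : ℝ))) := by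
    filter_upwards [eventually_lt_of_limsup_lt h1, h01] with r hr hr'
    exact sepNumber_le_rpow_of_log_div_lt hr'.1 hr'.2 hr
  have h3 : ∀ r : ℝ, ∃ S : Finset X, 0 < r →
      (sepNumber r A : ℝ≥0∞) ≤ ENNReal.ofReal (r ^ (-(s : ℝ))) →
      A ⊆ ⋃ x ∈ S, Metric.closedBall x r ∧ (S.card : ℝ≥0∞) ≤ ENNReal.ofReal (r ^ (-(s : ℝ))) := by
    intro r
    by_cases h : 0 < r ∧ (sepNumber r A : ℝ≥0∞) ≤ ENNReal.ofReal (r ^ (-(s : ℝ)))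
    · have h4 : sepNumber r A ≠ ⊤ := by
        intro h5
        rw [h5] at h
        exact absurd h.2 (by simp)
      obtain ⟨S, hS, hS'⟩ := exists_finset_cover h.1.le h4
      refine ⟨S, fun _ _ => ⟨hS, le_trans ?_ h.2⟩⟩
      exact_mod_cast hS'
    · exact ⟨∅, fun h5 h6 => absurd ⟨h5, h6⟩ h⟩
  choose S hS using h3
  refine dimH_le_of_hausdorffMeasure_ne_top (ne_top_of_le_ne_top ?_
    (hausdorffMeasure_le_liminf_sum (ι := fun r : ℝ => S r) (s : ℝ) A
      (l := 𝓝[>] (0 : ℝ)) (fun r => 2 * ENNReal.ofReal r) ?_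
      (fun r x => Metric.closedBall (x : X) r) ?_ ?_))
  · have h5 : ∀ᶠ r : ℝ in 𝓝[>] 0,
        ∑ x : S r, Metric.ediam (Metric.closedBall (x : X) r) ^ (s : ℝ) ≤ 2 ^ (s : ℝ) := by
      filter_upwards [h2, h01] with r hr hr'
      calc ∑ x : S r, Metric.ediam (Metric.closedBall (x : X) r) ^ (s : ℝ)
          ≤ ∑ x : S r, (2 * ENNReal.ofReal r) ^ (s : ℝ) := by
            gcongr with x
            exact ediam_closedBall_le_two_mul r
        _ = (S r).card * (2 * ENNReal.ofReal r) ^ (s : ℝ) := by simp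
        _ ≤ ENNReal.ofReal (r ^ (-(s : ℝ))) * (2 * ENNReal.ofReal r) ^ (s : ℝ) := by
            gcongr
            exact (hS r hr'.1 hr).2
        _ = 2 ^ (s : ℝ) := by
            rw [ENNReal.mul_rpow_of_nonneg _ _ s.coe_nonneg, ENNReal.ofReal_rpow_of_pos hr'.1, mul_left_comm,
              ← ENNReal.ofReal_mul (by have := hr'.1; positivity), ← Real.rpow_add hr'.1]
            simp
    refine ne_top_of_le_ne_top (b := 2 ^ (s : ℝ)) (by simp) ?_
    exact liminf_le_of_frequently_le' h5.frequently
  · have : Tendsto (fun r : ℝ => 2 * ENNReal.ofReal r) (𝓝 0) (𝓝 (2 * ENNReal.ofReal 0)) :=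
      ENNReal.Tendsto.const_mul (ENNReal.continuous_ofReal.tendsto 0) (by simp)
    simp only [ENNReal.ofReal_zero, mul_zero] at this
    exact this.mono_left nhdsWithin_le_nhds
  · filter_upwards [h01] with r hr x
    exact ediam_closedBall_le_two_mul r
  · filter_upwards [h2, h01] with r hr hr'
    refine (hS r hr'.1 hr).1.trans fun x hx => ?_
    simpa using hx

theorem dimH_le_packingDim {X : Type*} [MetricSpace X] (A : Set X) :
    dimH A ≤ packingDim A := by
  refine le_iInf₂ fun c hc => ?_
  rw [hc, dimH_iUnion]
  exact iSup_mono fun i => dimH_le_upperBoxDim (c i)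

theorem packingDim_le {X : Type*} [MetricSpace X] {A : Set X} {c : ℕ → Set X} {s : ℝ≥0∞}
    (hA : A = ⋃ i, c i) (h : ∀ i, upperBoxDim (c i) ≤ s) : packingDim A ≤ s :=
  iInf₂_le_of_le c hA (iSup_le h)

/-- Rounding `r` down to a power of `1/2` costs at most a factor `2^s`; this and `C` are absorbed by
`ε · (-log r)` as `r → 0`. -/
theorem upperBoxDim_le {X : Type*} [MetricSpace X] {A : Set X} {C s : ℝ} (hC : 0 < C) (hs : 0 ≤ s)
    (h : ∀ (n : ℕ) (r : ℝ), (1 / 2) ^ n < r →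
      (sepNumber r A : ℝ≥0∞) ≤ ENNReal.ofReal (C * 2 ^ (s * n))) :
    upperBoxDim A ≤ ENNReal.ofReal s := by
  refine ENNReal.le_of_forall_pos_le_add fun ε hε _ => ?_
  have hε' : (0 : ℝ) < ε := hε
  rw [← ENNReal.ofReal_coe_nnreal, ← ENNReal.ofReal_add hs ε.coe_nonneg, ← EReal.real_coe_toENNReal]
  refine EReal.toENNReal_le_toENNReal (limsup_le_of_le (h := ?_))
  have h01 : ∀ᶠ r : ℝ in 𝓝[>] 0, 0 < r ∧ r < 1 := Ioo_mem_nhdsGT one_pos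
  have h2 : ∀ᶠ r : ℝ in 𝓝[>] 0, Real.log r ≤ -((Real.log C + s * Real.log 2) / ε) :=
    Real.tendsto_log_nhdsGT_zero.eventually_le_atBot _
  filter_upwards [h01, h2] with r hr hr2
  have hlog : 0 < -Real.log r := neg_pos.2 (Real.log_neg hr.1 hr.2)
  have hlog2 : 0 < Real.log 2 := Real.log_pos one_lt_two
  rw [EReal.div_le_iff_le_mul (by exact_mod_cast hlog) (EReal.coe_ne_top _), ← EReal.coe_mul]
  set n : ℕ := ⌊-Real.log r / Real.log 2⌋₊ + 1 with hn
  have hn1 : -Real.log r < n * Real.log 2 := by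
    rw [← div_lt_iff₀ hlog2, hn]; push_cast; exact Nat.lt_floor_add_one _
  have hn2 : n * Real.log 2 ≤ -Real.log r + Real.log 2 := by
    have : (⌊-Real.log r / Real.log 2⌋₊ : ℝ) * Real.log 2 ≤ -Real.log r := by
      rw [← le_div_iff₀ hlog2]; exact Nat.floor_le (by positivity)
    rw [hn]; push_cast; linarith
  have hnr : (1 / 2 : ℝ) ^ n < r := by
    rw [← Real.log_lt_log_iff (by positivity) hr.1, Real.log_pow, one_div, Real.log_inv]
    linarith
  refine (ENNReal.log_monotone (h n r hnr)).trans ?_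
  rw [ENNReal.log_ofReal_of_pos (by positivity)]
  rw [EReal.coe_le_coe_iff, Real.log_mul hC.ne' (by positivity), Real.log_rpow two_pos]
  have h5 : Real.log C + s * Real.log 2 ≤ ε * -Real.log r := by
    rw [← div_le_iff₀' hε']; linarith
  nlinarith

/-- The Hausdorff dimension of a limsup set, from a summable family of covers. -/
theorem dimH_le_of_frequently_mem {X : Type*} [MetricSpace X] {A : Set X} {s : ℝ≥0}
    {ι : ℕ → Type*} [∀ k, Fintype (ι k)] {t : ∀ k, ι k → Set X} {δ : ℕ → ℝ≥0∞}
    (hδ : Antitone δ) (hδ0 : Tendsto δ atTop (𝓝 0)) (ht : ∀ k i, Metric.ediam (t k i) ≤ δ k)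
    (hsum : ∑' k, (Fintype.card (ι k) : ℝ≥0∞) * δ k ^ (s : ℝ) ≠ ⊤)
    (hA : ∀ x ∈ A, ∃ᶠ k in atTop, ∃ i, x ∈ t k i) : dimH A ≤ s := by
  borelize X
  refine dimH_le_of_hausdorffMeasure_ne_top (ne_top_of_le_ne_top ?_
    (hausdorffMeasure_le_liminf_tsum (ι := fun n : ℕ => Σ k : ℕ, ι (k + n)) (s : ℝ) A
      (l := atTop) δ hδ0 (fun n p => t (p.1 + n) p.2) ?_ ?_))
  · have h1 := (ENNReal.tendsto_sum_nat_add _ hsum)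
    refine ne_top_of_le_ne_top ENNReal.zero_ne_top ?_
    rw [← h1.liminf_eq]
    refine liminf_le_liminf (Eventually.of_forall fun n => ?_)
    rw [ENNReal.tsum_sigma']
    refine ENNReal.tsum_le_tsum fun k => ?_
    rw [tsum_fintype]
    refine (Finset.sum_le_sum fun i _ => ENNReal.rpow_le_rpow (ht (k + n) i) s.coe_nonneg).trans ?_
    simp
  · exact Eventually.of_forall fun n p => (ht _ _).trans (hδ (Nat.le_add_left _ _))
  · refine Eventually.of_forall fun n x hx => ?_
    obtain ⟨k, hk, i, hi⟩ := frequently_atTop.1 (hA x hx) n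
    obtain ⟨l, rfl⟩ := Nat.exists_eq_add_of_le' hk
    exact mem_iUnion.2 ⟨⟨l, i⟩, hi⟩

/-- A set containing an expanding image of the unit interval has large dimension. -/
theorem le_dimH_of_expanding {A : Set ℝ} {s C : ℝ≥0} (hs : 0 < s) {g : ℝ → ℝ}
    (hg : ∀ x ∈ Icc (0 : ℝ) 1, g x ∈ A)
    (h : ∀ x ∈ Icc (0 : ℝ) 1, ∀ y ∈ Icc (0 : ℝ) 1, |x - y| ≤ C * |g x - g y| ^ (s : ℝ)) :
    (s : ℝ≥0∞) ≤ dimH A := by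
  have hs' : (0 : ℝ) < s := hs
  have hinj : InjOn g (Icc (0 : ℝ) 1) := by
    intro x hx y hy hxy
    have h1 := h x hx y hy
    rw [hxy, sub_self, abs_zero, Real.zero_rpow hs'.ne', mul_zero] at h1
    exact sub_eq_zero.1 (abs_nonpos_iff.1 h1)
  set f := Function.invFunOn g (Icc (0 : ℝ) 1)
  have hf : ∀ x ∈ Icc (0 : ℝ) 1, f (g x) = x := fun x hx => hinj.leftInvOn_invFunOn hx
  have hH : HolderOnWith C s f (g '' Icc (0 : ℝ) 1) := by
    rintro _ ⟨x, hx, rfl⟩ _ ⟨y, hy, rfl⟩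
    rw [hf x hx, hf y hy, edist_dist, edist_dist, ENNReal.ofReal_rpow_of_nonneg dist_nonneg hs'.le,
      ← ENNReal.ofReal_coe_nnreal, ← ENNReal.ofReal_mul C.coe_nonneg, Real.dist_eq, Real.dist_eq]
    exact ENNReal.ofReal_le_ofReal (h x hx y hy)
  have h1 := hH.dimH_image_le hs
  have h2 : f '' (g '' Icc (0 : ℝ) 1) = Icc 0 1 := by
    rw [image_image]
    exact (image_congr hf).trans (image_id _)
  rw [h2, Real.dimH_of_nonempty_interior (by simp), Module.finrank_self, Nat.cast_one,
    ENNReal.le_div_iff_mul_le (Or.inl (by simpa using hs.ne')) (Or.inl ENNReal.coe_ne_top),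
    one_mul] at h1
  exact h1.trans (dimH_mono (image_subset_iff.2 hg))

end Dimension

/-! ### Dimension and separation numbers of sets of codes with free positions -/

theorem ofDigits_tail_injective {d e : ℕ → Fin 2} {n : ℕ} (h : ∀ i, n ≤ i → d i = e i)
    (hde : Real.ofDigits d = Real.ofDigits e) (i : ℕ) : d i = e i := by
  rcases lt_or_ge i n with hi | hi
  · refine eq_of_prefixNat_eq ?_ i hi
    have h1 := two_pow_mul_ofDigits d n
    have h2 := two_pow_mul_ofDigits e n
    have h3 : (fun i => d (i + n)) = fun i => e (i + n) := by
      funext i; exact h _ (by omega)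
    rw [h3, hde, h2] at h1
    exact_mod_cast (add_right_cancel h1).symm
  · exact h i hi

theorem half_pow_eq_rpow (n : ℕ) : (1 / 2 : ℝ) ^ n = 2 ^ (-(n : ℝ)) := by
  rw [Real.rpow_neg two_pos.le, Real.rpow_natCast, one_div, inv_pow]

/-- Successive numbers `2k²` near `i` are `O(√i)` apart. This bounds the cost of waiting, after two
codes differ at `i`, for the next forced zero, where the separation estimate applies. -/
theorem exists_two_mul_sq_near {ε : ℝ} (hε : 0 < ε) :
    ∃ C : ℝ, 0 ≤ C ∧ ∀ i : ℕ, ∃ k : ℕ, i ≤ 2 * k ^ 2 ∧ (2 * (k : ℝ) ^ 2) ≤ (1 + ε) * i + C := by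
  refine ⟨4 * (1 / (ε / 4)) + 2, by positivity, fun i => ⟨Nat.sqrt (i / 2) + 1, ?_, ?_⟩⟩
  · have h1 := Nat.lt_succ_sqrt' (i / 2)
    simp only [Nat.succ_eq_add_one] at h1
    omega
  · have h1 : Nat.sqrt (i / 2) * Nat.sqrt (i / 2) ≤ i / 2 := Nat.sqrt_le _
    have h2 : Nat.sqrt (i / 2) ≤ Nat.sqrt i := Nat.sqrt_le_sqrt (Nat.div_le_self _ _)
    have h3 := nat_sqrt_le_mul_add (show 0 < ε / 4 by positivity) i
    have h4 : 2 * (Nat.sqrt (i / 2) + 1) ^ 2 ≤ i + 4 * Nat.sqrt i + 2 := by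
      have h5 : 2 * (Nat.sqrt (i / 2) * Nat.sqrt (i / 2)) ≤ i := by omega
      nlinarith
    have h5 : (2 * ((Nat.sqrt (i / 2) + 1 : ℕ) : ℝ) ^ 2) ≤ i + 4 * Nat.sqrt i + 2 := by
      exact_mod_cast h4
    linarith

/-- A set of codes with prescribed digits off `T` has dimension at least the density of `T`. -/
theorem le_dimH_of_free_bits {T : Set ℕ} {d₀ : ℕ → Fin 2} {A : Set ℝ} {s s' C : ℝ} (hs : 0 < s)
    (hss' : s < s') (hT : ∀ k, 2 * k ^ 2 + 1 ∉ T) (hd₀ : ∀ k, d₀ (2 * k ^ 2 + 1) = 0)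
    (hA : ∀ d : ℕ → Fin 2, (∀ i ∉ T, d i = d₀ i) → Real.ofDigits d ∈ A)
    (hcard : ∀ i : ℕ, s' * i - C ≤ (bitsIn T 0 i).card) :
    ENNReal.ofReal s ≤ dimH A := by
  classical
  have hs' : 0 < s' := hs.trans hss'
  have hdig : ∀ x : ℝ, ∃ e : ℕ → Fin 2, x ∈ Icc (0 : ℝ) 1 → Real.ofDigits e = x := fun x => by
    by_cases hx : x ∈ Icc (0 : ℝ) 1
    · obtain ⟨e, -, he⟩ := Real.ofDigits_SurjOn one_lt_two hx
      exact ⟨e, fun _ => he⟩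
    · exact ⟨0, fun h => absurd h hx⟩
  choose dig hdig using hdig
  -- The digits of `x` are written in order into the positions of `T`, so the first difference, at
  -- digit `m`, moves to the position `i` preceded by exactly `m` elements of `T`.
  set code : ℝ → ℕ → Fin 2 := fun x i => if i ∈ T then dig x (bitsIn T 0 i).card else d₀ i
    with hcode
  obtain ⟨C₁, hC₁, hnear⟩ := exists_two_mul_sq_near (ε := s' / s - 1)
    (by rw [sub_pos, one_lt_div hs]; exact hss')
  -- `C` is the error in the density, `C₁` the error in reaching the next `2k²`, and `2` the passage
  -- from `2k²` to the separation exponent `2k² + 2`.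
  set D : ℝ := C + s * (C₁ + 2) with hD
  have key := le_dimH_of_expanding (A := A) (s := s.toNNReal) (C := ((2 : ℝ) ^ D).toNNReal)
    (g := fun x => Real.ofDigits (code x)) (by simpa using hs)
    (fun x _ => hA _ fun i hi => by simp [hcode, hi]) ?_
  · exact key
  intro x hx y hy
  rw [Real.coe_toNNReal _ (by positivity), Real.coe_toNNReal _ hs.le]
  by_cases hxy : x = y
  · rw [hxy, sub_self, abs_zero]; positivity
  have hex : ∃ m, dig x m ≠ dig y m := by
    by_contra! h
    exact hxy (by rw [← hdig x hx, ← hdig y hy, funext h])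
  set m := Nat.find hex with hm
  have hm1 : |x - y| ≤ (1 / 2) ^ m := by
    have := abs_ofDigits_sub_le (d := dig x) (e := dig y) (n := m) fun i hi => by
      simpa using Nat.find_min hex hi
    rwa [hdig x hx, hdig y hy] at this
  have hunb : ∃ n, m < (bitsIn T 0 n).card := by
    obtain ⟨n, hn⟩ := exists_nat_gt ((m + C) / s')
    rw [div_lt_iff₀ hs'] at hn
    refine ⟨n, ?_⟩
    have := hcard n
    have h2 : (m : ℝ) < (bitsIn T 0 n).card := by linarith
    exact_mod_cast h2
  obtain ⟨i, hiT, hi⟩ : ∃ i ∈ T, (bitsIn T 0 i).card = m := by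
    have h1 := Nat.find_spec hunb
    have h2 : Nat.find hunb ≠ 0 := fun h => by
      rw [h, bitsIn_self] at h1; simp at h1
    obtain ⟨i, hi⟩ := Nat.exists_eq_succ_of_ne_zero h2
    have h3 := Nat.find_min hunb (m := i) (by omega)
    rw [hi, Nat.succ_eq_add_one] at h1
    by_cases hiT : i ∈ T
    · rw [bitsIn_succ_of_mem (Nat.zero_le _) hiT] at h1
      exact ⟨i, hiT, by omega⟩
    · rw [bitsIn_succ_of_notMem hiT] at h1
      exact absurd h1 h3
  obtain ⟨k, hk1, hk2⟩ := hnear i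
  have hsep := le_abs_ofDigits_sub_of_zero (d := code x) (e := code y) (i := i)
    (n := 2 * k ^ 2 + 1) (by omega) (by simp only [hcode, hiT, if_true, hi]; exact Nat.find_spec hex)
    (by simp [hcode, hT, hd₀]) (by simp [hcode, hT, hd₀])
  have hexp : s * (2 * (k : ℝ) ^ 2 + 2) - m ≤ D := by
    have h1 := hcard i
    rw [hi] at h1
    have h2 : s * (2 * (k : ℝ) ^ 2) ≤ s * ((1 + (s' / s - 1)) * i + C₁) := by gcongr
    have h3 : s * ((1 + (s' / s - 1)) * i + C₁) = s' * i + s * C₁ := by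
      field_simp; ring
    rw [hD]; linarith
  calc |x - y| ≤ (1 / 2) ^ m := hm1
    _ = 2 ^ (-(m : ℝ)) := half_pow_eq_rpow m
    _ ≤ 2 ^ (D + -(s * (2 * (k : ℝ) ^ 2 + 2))) :=
      Real.rpow_le_rpow_of_exponent_le one_le_two (by linarith)
    _ = 2 ^ D * ((1 / 2) ^ (2 * k ^ 2 + 1 + 1)) ^ s := by
      rw [Real.rpow_add two_pos, half_pow_eq_rpow, ← Real.rpow_mul two_pos.le]
      congr 2
      push_cast
      ring
    _ ≤ 2 ^ D * |Real.ofDigits (code x) - Real.ofDigits (code y)| ^ s := by gcongr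

theorem eq_of_filter_eq {d e : ℕ → Fin 2} {T : Finset ℕ} {n : ℕ}
    (hd : ∀ i < n, d i = 1 → i ∈ T) (he : ∀ i < n, e i = 1 → i ∈ T)
    (h : T.filter (fun i => d i = 1) = T.filter fun i => e i = 1) : ∀ i < n, d i = e i := by
  intro i hi
  have h3 : i ∈ T.filter (fun i => d i = 1) ↔ i ∈ T.filter (fun i => e i = 1) := by rw [h]
  simp only [Finset.mem_filter] at h3
  by_cases h6 : d i = 1
  · rw [h6, (h3.1 ⟨hd i hi h6, h6⟩).2]
  · by_cases h7 : e i = 1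
    · exact absurd (h3.2 ⟨he i hi h7, h7⟩).2 h6
    · rw [fin_two_eq_zero h6, fin_two_eq_zero h7]

/-- The separation number of a set of codes with few free positions. -/
theorem sepNumber_image_ofDigits_le {D : Set (ℕ → Fin 2)} {T : Finset ℕ} {n : ℕ} {r : ℝ}
    (hD : ∀ d ∈ D, ∀ i < n, d i = 1 → i ∈ T) (hr : (1 / 2) ^ n < r) :
    sepNumber r (Real.ofDigits '' D) ≤ (2 ^ T.card : ℕ) := by
  refine iSup₂_le fun S hS => ?_
  have h1 : ∀ x : ℝ, ∃ d : ℕ → Fin 2, x ∈ S → d ∈ D ∧ Real.ofDigits d = x := fun x => by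
    by_cases hx : x ∈ S
    · obtain ⟨d, hd, hdx⟩ := hS.1 hx
      exact ⟨d, fun _ => ⟨hd, hdx⟩⟩
    · exact ⟨0, fun h => absurd h hx⟩
  choose code hcode using h1
  rw [← Finset.card_powerset, ← encard_coe_eq_coe_finsetCard]
  refine encard_le_encard_of_injOn (f := fun x => T.filter fun i => code x i = 1)
    (fun x _ => Finset.mem_coe.2 (Finset.mem_powerset.2 (Finset.filter_subset _ _))) fun x hx y hy hxy => ?_
  by_contra hne
  have h2 : ∀ i < n, code x i = code y i :=
    eq_of_filter_eq (hD _ (hcode x hx).1) (hD _ (hcode y hy).1) hxy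
  have h3 := abs_ofDigits_sub_le h2
  rw [(hcode x hx).2, (hcode y hy).2, ← Real.dist_eq] at h3
  exact absurd (hS.2 hx hy hne) (not_le.2 (h3.trans_lt hr))

/-! ### The set -/

/-- The codes whose digits are free on `G` up to the first position `2k²` carrying a one, if any,
and free on `G'` from then on. -/
def codeSet (G' G : Set ℕ) : Set (ℕ → Fin 2) :=
  {d | (∀ i, d i = 1 → i ∈ G ∨ ∃ k, i = 2 * k ^ 2) ∧
    ∀ k, d (2 * k ^ 2) = 1 → ∀ i, 2 * k ^ 2 < i → d i = 1 → i ∈ G'}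

/-- The points with code in `codeSet G' G`. -/
def pointSet (G' G : Set ℕ) : Set ℝ := Real.ofDigits '' codeSet G' G

/-- Each condition on a code involves at most two digits, so the codes form a closed subset of
Cantor space. -/
theorem isCompact_pointSet (G' G : Set ℕ) : IsCompact (pointSet G' G) := by
  refine IsCompact.image (IsClosed.isCompact ?_) Real.continuous_ofDigits
  have h1 : ∀ i, IsClopen {d : ℕ → Fin 2 | d i = 1} := fun i =>
    (isClopen_discrete {(1 : Fin 2)}).preimage (continuous_apply i)
  have h2 : ∀ p : Prop, IsClosed {_d : ℕ → Fin 2 | p} := fun p => isClosed_const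
  have h3 : codeSet G' G = (⋂ i, {d | d i = 1 → i ∈ G ∨ ∃ k, i = 2 * k ^ 2}) ∩
      ⋂ (k : ℕ) (i : ℕ), {d | d (2 * k ^ 2) = 1 → 2 * k ^ 2 < i → d i = 1 → i ∈ G'} := by
    ext d
    simp only [codeSet, mem_inter_iff, mem_iInter, mem_ofPred_eq]
    exact and_congr Iff.rfl ⟨fun h k i a b c => h k a i b c, fun h k a i b c => h k i a b c⟩
  rw [h3]
  refine IsClosed.inter (isClosed_iInter fun i => ?_)
    (isClosed_iInter fun k => isClosed_iInter fun i => ?_)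
  · exact isClosed_imp (h1 i).isOpen (h2 _)
  · exact isClosed_imp (h1 _).isOpen (isClosed_imp (by exact isOpen_const)
      (isClosed_imp (h1 _).isOpen (h2 _)))

theorem pointSet_subset_Icc (G' G : Set ℕ) : pointSet G' G ⊆ Icc 0 1 := by
  rintro _ ⟨d, -, rfl⟩
  exact ⟨Real.ofDigits_nonneg d, Real.ofDigits_le_one d⟩

/-! ### Hausdorff and packing dimension of the set -/

namespace IsBitPattern

variable {L H : ℝ} {G' G : Set ℕ}

theorem notMem' (h : IsBitPattern L H G' G) (k : ℕ) : 2 * k ^ 2 ∉ G' :=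
  fun hk => h.notMem k (h.subset hk)

theorem succ_notMem' (h : IsBitPattern L H G' G) (k : ℕ) : 2 * k ^ 2 + 1 ∉ G' :=
  fun hk => h.succ_notMem k (h.subset hk)

/-- Parity keeps `2k² + 1` away from the escape positions. These forced zeros are the source of
every gap used below. -/
theorem succ_eq_zero (h : IsBitPattern L H G' G) {d : ℕ → Fin 2} (hd : d ∈ codeSet G' G) (k : ℕ) :
    d (2 * k ^ 2 + 1) = 0 := by
  refine fin_two_eq_zero fun h1 => ?_
  rcases hd.1 _ h1 with h2 | ⟨j, hj⟩
  · exact h.succ_notMem k h2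
  · omega

theorem zero_mem_codeSet : (0 : ℕ → Fin 2) ∈ codeSet G' G :=
  ⟨fun i hi => by simp at hi, fun k hk => by simp at hk⟩

theorem zero_mem_pointSet : (0 : ℝ) ∈ pointSet G' G :=
  ⟨0, zero_mem_codeSet, by simp [Real.ofDigits, Real.ofDigitsTerm]⟩

/-- Codes that leave the main part at position `2k²`. -/
def escapeSet (G' G : Set ℕ) (k : ℕ) : Set (ℕ → Fin 2) := {d | d ∈ codeSet G' G ∧ d (2 * k ^ 2) = 1}

/-- Codes that never leave the main part. -/
def mainSet (G' G : Set ℕ) : Set (ℕ → Fin 2) := {d | d ∈ codeSet G' G ∧ ∀ k, d (2 * k ^ 2) ≠ 1}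

/-- The digits up to the escape contribute only a constant factor depending on `k`; all later ones
lie in `G'`. -/
theorem sepNumber_escapeSet_le (h : IsBitPattern L H G' G) (k n : ℕ) {r : ℝ}
    (hr : (1 / 2) ^ n < r) :
    (sepNumber r (Real.ofDigits '' escapeSet G' G k) : ℝ≥0∞) ≤
      ENNReal.ofReal (2 ^ (2 * k ^ 2 + 1) * 2 ^ (L * n)) := by
  have h1 := sepNumber_image_ofDigits_le (D := escapeSet G' G k)
    (T := Finset.range (2 * k ^ 2 + 1) ∪ bitsIn G' 0 n) (fun d hd i hi hdi => by
      rw [Finset.mem_union, Finset.mem_range, mem_bitsIn]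
      rcases lt_or_ge (2 * k ^ 2) i with hik | hik
      · exact Or.inr ⟨⟨Nat.zero_le _, hi⟩, hd.1.2 k hd.2 i hik hdi⟩
      · exact Or.inl (by omega)) hr
  have h2 : (sepNumber r (Real.ofDigits '' escapeSet G' G k) : ℝ≥0∞) ≤
      ((2 ^ (Finset.range (2 * k ^ 2 + 1) ∪ bitsIn G' 0 n).card : ℕ) : ℝ≥0∞) := by
    exact_mod_cast h1
  refine h2.trans ?_
  rw [← ENNReal.ofReal_natCast]
  refine ENNReal.ofReal_le_ofReal ?_
  have h3 := Finset.card_union_le (Finset.range (2 * k ^ 2 + 1)) (bitsIn G' 0 n)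
  rw [Finset.card_range] at h3
  calc ((2 ^ (Finset.range (2 * k ^ 2 + 1) ∪ bitsIn G' 0 n).card : ℕ) : ℝ)
      ≤ ((2 ^ (2 * k ^ 2 + 1 + (bitsIn G' 0 n).card) : ℕ) : ℝ) := by
        exact_mod_cast Nat.pow_le_pow_right two_pos h3
    _ = 2 ^ (2 * k ^ 2 + 1) * 2 ^ ((bitsIn G' 0 n).card : ℝ) := by
        rw [Real.rpow_natCast]; push_cast; rw [pow_add]
    _ ≤ 2 ^ (2 * k ^ 2 + 1) * 2 ^ (L * n) := by
        gcongr
        · norm_num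
        · exact h.card_le' n

theorem sepNumber_mainSet_le (h : IsBitPattern L H G' G) (n : ℕ) {r : ℝ}
    (hr : (1 / 2) ^ n < r) :
    (sepNumber r (Real.ofDigits '' mainSet G' G) : ℝ≥0∞) ≤ ENNReal.ofReal (1 * 2 ^ (H * n)) := by
  have h1 := sepNumber_image_ofDigits_le (D := mainSet G' G) (T := bitsIn G 0 n)
    (fun d hd i hi hdi => by
      rw [mem_bitsIn]
      refine ⟨⟨Nat.zero_le _, hi⟩, (hd.1.1 i hdi).resolve_right ?_⟩
      rintro ⟨k, rfl⟩
      exact hd.2 k hdi) hr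
  have h2 : (sepNumber r (Real.ofDigits '' mainSet G' G) : ℝ≥0∞) ≤
      ((2 ^ (bitsIn G 0 n).card : ℕ) : ℝ≥0∞) := by
    exact_mod_cast h1
  refine h2.trans ?_
  rw [← ENNReal.ofReal_natCast]
  refine ENNReal.ofReal_le_ofReal ?_
  rw [one_mul, Nat.cast_pow, ← Real.rpow_natCast, Nat.cast_ofNat]
  exact Real.rpow_le_rpow_of_exponent_le one_le_two (h.card_le n)

/-- The main part and the countably many escaped pieces are used as the decomposition; the constants
need not be uniform over the pieces. -/
theorem packingDim_pointSet_le (h : IsBitPattern L H G' G) (hL : 0 ≤ L) (hLH : L ≤ H) :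
    packingDim (pointSet G' G) ≤ ENNReal.ofReal H := by
  refine packingDim_le (c := fun n => Nat.casesOn n (Real.ofDigits '' mainSet G' G)
    fun k => Real.ofDigits '' escapeSet G' G k) ?_ fun n => ?_
  · ext x
    rw [mem_iUnion]
    constructor
    · rintro ⟨d, hd, rfl⟩
      by_cases hk : ∃ k, d (2 * k ^ 2) = 1
      · obtain ⟨k, hk⟩ := hk
        exact ⟨k + 1, d, ⟨hd, hk⟩, rfl⟩
      · exact ⟨0, d, ⟨hd, fun k hk' => hk ⟨k, hk'⟩⟩, rfl⟩
    · rintro ⟨_ | k, d, hd, rfl⟩ <;> exact ⟨d, hd.1, rfl⟩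
  · cases n with
    | zero =>
      exact upperBoxDim_le one_pos (hL.trans hLH) fun n r hr => h.sepNumber_mainSet_le n hr
    | succ k =>
      refine (upperBoxDim_le (C := 2 ^ (2 * k ^ 2 + 1)) (by positivity) hL fun n r hr =>
        h.sepNumber_escapeSet_le k n hr).trans (ENNReal.ofReal_le_ofReal hLH)

theorem le_dimH_pointSet (h : IsBitPattern L H G' G) :
    ENNReal.ofReal H ≤ dimH (pointSet G' G) := by
  refine ENNReal.le_of_forall_nnreal_lt fun s hs => ?_
  rcases eq_or_ne s 0 with rfl | hs0
  · simp
  have hs0' : (0 : ℝ) < s := by positivity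
  have hsH : (s : ℝ) < H := by
    by_contra h'
    rw [← ENNReal.ofReal_coe_nnreal] at hs
    exact absurd hs (not_lt.2 (ENNReal.ofReal_le_ofReal (not_lt.1 h')))
  rw [← ENNReal.ofReal_coe_nnreal]
  obtain ⟨C, hC⟩ := h.le_card ((H - s) / 2) (by linarith)
  refine le_dimH_of_free_bits (T := G) (d₀ := 0) (s' := (s + H) / 2) (C := C) hs0' (by linarith)
    h.succ_notMem (fun _ => rfl) (fun d hd => ?_) fun i => ?_
  · have h1 : ∀ i, d i = 1 → i ∈ G := fun i hi => by
      by_contra hiG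
      rw [hd i hiG] at hi
      simp at hi
    exact ⟨d, ⟨fun i hi => Or.inl (h1 i hi), fun k hk => absurd (h1 _ hk) (h.notMem k)⟩, rfl⟩
  · have := hC 0 i (Nat.zero_le i)
    push_cast at this
    linarith

theorem dimH_pointSet (h : IsBitPattern L H G' G) (hL : 0 ≤ L) (hLH : L ≤ H) :
    dimH (pointSet G' G) = ENNReal.ofReal H :=
  le_antisymm ((dimH_le_packingDim _).trans (h.packingDim_pointSet_le hL hLH)) h.le_dimH_pointSet

theorem packingDim_pointSet (h : IsBitPattern L H G' G) (hL : 0 ≤ L) (hLH : L ≤ H) :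
    packingDim (pointSet G' G) = ENNReal.ofReal H :=
  le_antisymm (h.packingDim_pointSet_le hL hLH) (h.le_dimH_pointSet.trans (dimH_le_packingDim _))

end IsBitPattern

/-! ### The lower dimension -/

namespace IsBitPattern

variable {L H : ℝ} {G' G : Set ℕ}

theorem half_le_ofDigits {d : ℕ → Fin 2} (h : d 0 = 1) : 1 / 2 ≤ Real.ofDigits d := by
  have h1 := two_pow_mul_ofDigits d 1
  have h2 := Real.ofDigits_nonneg (fun i => d (i + 1))
  simp [prefixNat, h] at h1
  linarith

theorem ofDigits_le_quarter (h : IsBitPattern L H G' G) {d : ℕ → Fin 2} (hd : d ∈ codeSet G' G)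
    (h0 : d 0 = 0) : Real.ofDigits d ≤ 1 / 4 := by
  have h1 := two_pow_mul_ofDigits d 1
  have h2 : Real.ofDigits (fun i => d (i + 1)) ≤ 1 / 2 :=
    ofDigits_le_half (by simpa using h.succ_eq_zero hd 0)
  simp [prefixNat, h0] at h1 h2
  linarith

theorem half_mem_pointSet : (1 / 2 : ℝ) ∈ pointSet G' G := by
  refine ⟨fun i => if i = 0 then 1 else 0, ⟨fun i hi => ?_, fun k hk i hki hi => ?_⟩, ?_⟩
  · have : i = 0 := by by_contra h; simp [h] at hi
    exact Or.inr ⟨0, by simpa using this⟩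
  · have : i = 0 := by by_contra h; simp [h] at hi
    omega
  · have h1 := two_pow_mul_ofDigits (fun i => if i = 0 then 1 else 0) 1
    have h2 : Real.ofDigits (fun i => (fun i => if i = 0 then 1 else 0 : ℕ → Fin 2) (i + 1)) = 0 := by
      simp [Real.ofDigits, Real.ofDigitsTerm]
    rw [h2] at h1
    simp [prefixNat] at h1
    linarith

theorem half_le_ediam_pointSet : ENNReal.ofReal (1 / 2) ≤ Metric.ediam (pointSet G' G) := by
  refine le_trans ?_ (Metric.edist_le_ediam_of_mem (half_mem_pointSet (G' := G') (G := G))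
    zero_mem_pointSet)
  rw [edist_dist, Real.dist_eq]
  norm_num

theorem ediam_pointSet_le : Metric.ediam (pointSet G' G) ≤ ENNReal.ofReal 1 := by
  refine (Metric.ediam_mono (pointSet_subset_Icc G' G)).trans ?_
  rw [Real.ediam_Icc]; norm_num

/-- Balls centred at points of the set contain many separated points. -/
theorem le_sepNumber_closedBall (h : IsBitPattern L H G' G) {d : ℕ → Fin 2}
    (hd : d ∈ codeSet G' G) {a b : ℕ} {r R : ℝ} (hR : (1 / 2) ^ a ≤ R) (hr : r ≤ (1 / 2) ^ b) :
    ((2 ^ (bitsIn G' a b).card : ℕ) : ℕ∞) ≤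
      sepNumber r (Metric.closedBall (Real.ofDigits d) R ∩ pointSet G' G) := by
  classical
  -- After position `a` only digits in `G'` are used. These are legal whether or not `d` has escaped
  -- before `a`, so the count holds at every point.
  set code : Finset ℕ → ℕ → Fin 2 := fun w i => if i < a then d i else if i ∈ w then 1 else 0
    with hcode
  have hmem : ∀ w ∈ (bitsIn G' a b).powerset, ∀ i, code w i = 1 →
      (i < a ∧ d i = 1) ∨ (a ≤ i ∧ i < b ∧ i ∈ w ∧ i ∈ G') := by
    intro w hw i hi
    by_cases hia : i < a
    · exact Or.inl ⟨hia, by simpa [hcode, hia] using hi⟩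
    · have hiw : i ∈ w := by
        by_contra hiw
        simp [hcode, hia, hiw] at hi
      have := mem_bitsIn.1 (Finset.mem_powerset.1 hw hiw)
      exact Or.inr ⟨by omega, this.1.2, hiw, this.2⟩
  have htail : ∀ w ∈ (bitsIn G' a b).powerset, ∀ w' ∈ (bitsIn G' a b).powerset, ∀ i, b ≤ i →
      code w i = code w' i := by
    intro w hw w' hw' i hi
    by_cases hia : i < a
    · simp [hcode, hia]
    · have h1 : i ∉ w := fun hiw => by
        have := mem_bitsIn.1 (Finset.mem_powerset.1 hw hiw); omega
      have h2 : i ∉ w' := fun hiw => by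
        have := mem_bitsIn.1 (Finset.mem_powerset.1 hw' hiw); omega
      simp [hcode, hia, h1, h2]
  have hinj : InjOn (fun w => Real.ofDigits (code w)) ((bitsIn G' a b).powerset : Set (Finset ℕ)) := by
    intro w hw w' hw' hww'
    have h1 := ofDigits_tail_injective (htail w hw w' hw') hww'
    ext i
    have h2 := h1 i
    by_cases hi : i ∈ bitsIn G' a b
    · have hia : ¬ i < a := by have := mem_bitsIn.1 hi; omega
      by_cases h3 : i ∈ w <;> by_cases h4 : i ∈ w' <;> simp [hcode, hia, h3, h4] at h2 ⊢
    · exact ⟨fun h3 => absurd (Finset.mem_powerset.1 hw h3) hi,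
        fun h3 => absurd (Finset.mem_powerset.1 hw' h3) hi⟩
  rw [← Finset.card_powerset, ← encard_coe_eq_coe_finsetCard, ← hinj.encard_image]
  refine le_sepNumber ?_ ?_
  · rintro _ ⟨w, hw, rfl⟩
    refine ⟨?_, code w, ⟨fun i hi => ?_, fun k hk i hki hi => ?_⟩, rfl⟩
    · rw [Metric.mem_closedBall, Real.dist_eq]
      exact (abs_ofDigits_sub_le fun i hi => by simp [hcode, hi]).trans hR
    · rcases hmem w hw i hi with h1 | h1
      · exact hd.1 i h1.2
      · exact Or.inl (h.subset h1.2.2.2)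
    · rcases hmem w hw _ hk with h1 | h1
      · rcases hmem w hw i hi with h2 | h2
        · exact hd.2 k h1.2 i hki h2.2
        · exact h2.2.2.2
      · exact absurd h1.2.2.2 (h.notMem' k)
  · rintro _ ⟨w, hw, rfl⟩ _ ⟨w', hw', rfl⟩ hne
    rw [Real.dist_eq]
    exact hr.trans (le_abs_ofDigits_sub_of_tail (htail w hw w' hw') hne)

theorem le_lowerDim_pointSet (h : IsBitPattern L H G' G) :
    ENNReal.ofReal L ≤ lowerDim (pointSet G' G) := by
  refine ENNReal.le_of_forall_nnreal_lt fun s hs => ?_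
  have hsL : (s : ℝ) < L := by
    by_contra h'
    rw [← ENNReal.ofReal_coe_nnreal] at hs
    exact absurd hs (not_lt.2 (ENNReal.ofReal_le_ofReal (not_lt.1 h')))
  obtain ⟨C, hC⟩ := h.le_card' (L - s) (by linarith)
  -- Rounding `R` and `r` to powers of `1/2` loses two digits, hence `2s`; `max C 0` also covers the
  -- case where no digit is left between the two scales.
  refine le_iSup₂_of_le s ⟨2 ^ (-(2 * s + max C 0) : ℝ), by positivity, ?_⟩ le_rfl
  rintro r R hr hrR hRF x ⟨d, hd, rfl⟩
  have hR : 0 < R := hr.trans hrR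
  have hR1 : R ≤ 1 := by
    have := hRF.trans ediam_pointSet_le
    rwa [ENNReal.ofReal_le_ofReal_iff one_pos.le] at this
  obtain ⟨a, ha1, ha2⟩ := exists_nat_pow_near_of_lt_one hR hR1
    (show (0 : ℝ) < 1 / 2 by norm_num) (by norm_num)
  obtain ⟨b, hb1, hb2⟩ := exists_nat_pow_near_of_lt_one hr (hrR.le.trans hR1)
    (show (0 : ℝ) < 1 / 2 by norm_num) (by norm_num)
  have hab : a ≤ b := by
    have h1 : (1 / 2 : ℝ) ^ (b + 1) < (1 / 2) ^ a := hb1.trans (hrR.trans_le ha2)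
    rw [pow_lt_pow_iff_right_of_lt_one₀ (by norm_num) (by norm_num)] at h1
    omega
  have hcount : (s : ℝ) * (b - (a + 1)) - max C 0 ≤ (bitsIn G' (a + 1) b).card := by
    rcases Nat.lt_or_ge a b with hlt | hge
    · have := hC (a + 1) b hlt
      have h2 := le_max_left C 0
      push_cast at this
      rw [sub_sub_cancel] at this
      linarith
    · have : b = a := le_antisymm hge hab
      have h2 := le_max_right C 0
      have h3 : (0 : ℝ) ≤ (bitsIn G' (a + 1) b).card := by positivity
      have h4 := s.coe_nonneg
      rw [this] at h3 ⊢
      linarith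
  have hmain := h.le_sepNumber_closedBall hd ha1.le hb2
  refine le_trans ?_ (show (((2 ^ (bitsIn G' (a + 1) b).card : ℕ) : ℕ∞) : ℝ≥0∞) ≤ _ by
    exact_mod_cast hmain)
  have hratio : R / r ≤ 2 ^ ((b : ℝ) + 1 - a) := by
    rw [div_le_iff₀ hr]
    have h1 : (2 : ℝ) ^ ((b : ℝ) + 1 - a) * 2 ^ (-((b + 1 : ℕ) : ℝ)) = 2 ^ (-(a : ℝ)) := by
      rw [← Real.rpow_add two_pos]; congr 1; push_cast; ring
    rw [half_pow_eq_rpow] at ha2 hb1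
    rw [← h1] at ha2
    exact ha2.trans (by gcongr)
  have hfin : (2 : ℝ) ^ (-(2 * s + max C 0) : ℝ) * (R / r) ^ (s : ℝ) ≤
      ((2 ^ (bitsIn G' (a + 1) b).card : ℕ) : ℝ) := by
    calc (2 : ℝ) ^ (-(2 * s + max C 0) : ℝ) * (R / r) ^ (s : ℝ)
        ≤ 2 ^ (-(2 * s + max C 0) : ℝ) * (2 ^ ((b : ℝ) + 1 - a)) ^ (s : ℝ) := by gcongr
      _ = 2 ^ ((s : ℝ) * (b - (a + 1)) - max C 0) := by
        rw [← Real.rpow_mul two_pos.le, ← Real.rpow_add two_pos]; congr 1; ring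
      _ ≤ 2 ^ ((bitsIn G' (a + 1) b).card : ℝ) :=
        Real.rpow_le_rpow_of_exponent_le one_le_two hcount
      _ = _ := by rw [Real.rpow_natCast]; push_cast; rfl
  refine (ENNReal.ofReal_le_ofReal hfin).trans ?_
  rw [ENNReal.ofReal_natCast]
  simp

theorem le_of_forall_rpow_le {s L C K : ℝ} (hC : 0 < C)
    (h : ∀ n : ℕ, 5 ≤ n → C * (2 : ℝ) ^ (s * n) ≤ K * 2 ^ (L * n)) : s ≤ L := by
  by_contra! hlt
  have h1 : Tendsto (fun n : ℕ => ((2 : ℝ) ^ (s - L)) ^ n) atTop atTop :=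
    tendsto_pow_atTop_atTop_of_one_lt (Real.one_lt_rpow one_lt_two (by linarith))
  obtain ⟨n, hn1, hn2⟩ := ((h1.eventually_gt_atTop (K / C)).and (eventually_ge_atTop 5)).exists
  have h2 := h n hn2
  rw [div_lt_iff₀ hC, ← Real.rpow_natCast, ← Real.rpow_mul two_pos.le] at hn1
  have h3 : (2 : ℝ) ^ (s * n) = 2 ^ ((s - L) * n) * 2 ^ (L * n) := by
    rw [← Real.rpow_add two_pos]; congr 1; ring
  rw [h3, ← mul_assoc] at h2
  have h4 := le_of_mul_le_mul_right h2 (by positivity)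
  linarith

/-- The gap between `1/4` and `1/2` isolates the codes that escape at position `0`, so the ball of
radius `1/8` about `1/2` sees only a piece with growth exponent `L`. -/
theorem lowerDim_pointSet_le (h : IsBitPattern L H G' G) :
    lowerDim (pointSet G' G) ≤ ENNReal.ofReal L := by
  refine iSup₂_le fun s ⟨C, hC, hCs⟩ => ?_
  rw [← ENNReal.ofReal_coe_nnreal]
  refine ENNReal.ofReal_le_ofReal (le_of_forall_rpow_le (C := C * (1 / 16) ^ (s : ℝ))
    (K := 2) (by positivity) fun n hn => ?_)
  have h1 : (1 / 2 : ℝ) ^ n ≤ (1 / 2) ^ 5 := pow_le_pow_of_le_one (by norm_num) (by norm_num) hn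
  -- The factor `2` makes the radius strictly larger than `2^(-n)`, as the count requires, and `n ≥
  -- 5` keeps it below `1/8`.
  have h2 := hCs (2 * (1 / 2) ^ n) (1 / 8) (by positivity) (by linarith)
    (le_trans (ENNReal.ofReal_le_ofReal (by norm_num)) half_le_ediam_pointSet) _ half_mem_pointSet
  have h3 : Metric.closedBall (1 / 2 : ℝ) (1 / 8) ∩ pointSet G' G ⊆
      Real.ofDigits '' escapeSet G' G 0 := by
    rintro _ ⟨hx, d, hd, rfl⟩
    refine ⟨d, ⟨hd, ?_⟩, rfl⟩
    by_contra h0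
    have h4 := h.ofDigits_le_quarter hd (fin_two_eq_zero h0)
    rw [Metric.mem_closedBall, Real.dist_eq, abs_le] at hx
    linarith [hx.1]
  have h4 : (0 : ℝ) < (1 / 2) ^ n := by positivity
  have h5 := h2.trans (le_trans (by exact_mod_cast sepNumber_mono h3)
    (h.sepNumber_escapeSet_le 0 n (r := 2 * (1 / 2) ^ n) (by linarith)))
  rw [ENNReal.ofReal_le_ofReal_iff (by positivity)] at h5
  have h6 : (1 / 8 / (2 * (1 / 2) ^ n) : ℝ) ^ (s : ℝ) = (1 / 16) ^ (s : ℝ) * 2 ^ (s * n : ℝ) := by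
    have h7 : (1 / 8 / (2 * (1 / 2) ^ n) : ℝ) = 1 / 16 * 2 ^ (n : ℝ) := by
      rw [Real.rpow_natCast, one_div_pow]; field_simp; norm_num
    rw [h7, Real.mul_rpow (by norm_num) (by positivity), ← Real.rpow_mul two_pos.le, mul_comm (s : ℝ)]
  rw [h6, ← mul_assoc] at h5
  simpa using h5

theorem lowerDim_pointSet (h : IsBitPattern L H G' G) :
    lowerDim (pointSet G' G) = ENNReal.ofReal L :=
  le_antisymm h.lowerDim_pointSet_le h.le_lowerDim_pointSet

end IsBitPattern

/-! ### Abstract rationals -/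

/-- In a compact set of reals, a maximal separated set can be chosen among points that are found
to the right of every point. -/
theorem exists_separated_cover {F Y : Set ℝ} (hF : IsCompact F) {r : ℝ} (hr : 0 < r)
    (hY : ∀ x ∈ F, ∃ y ∈ Y, x ≤ y ∧ y < x + r) :
    ∃ P ⊆ Y, IsSeparatedSet r P ∧ ∀ x ∈ F, ∃ p ∈ P, |x - p| < r := by
  -- Greedy sweep: take the least point `x₀` of `F` in `[a, ∞)`, choose `y ∈ Y` in `[x₀, x₀ + r)`,
  -- and restart at `y + r`. Points of `F` in between lie in `[x₀, y + r)`, within `r` of `y`; `n`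
  -- bounds the number of restarts.
  suffices key : ∀ (n : ℕ) (a : ℝ), (∀ x ∈ F, x < a + n * r) →
      ∃ P ⊆ Y ∩ Ici a, IsSeparatedSet r P ∧ ∀ x ∈ F, a ≤ x → ∃ p ∈ P, |x - p| < r by
    obtain ⟨b, hb⟩ := hF.bddAbove
    obtain ⟨a, ha⟩ := hF.bddBelow
    obtain ⟨n, hn⟩ := exists_nat_gt ((b - a) / r)
    rw [div_lt_iff₀ hr] at hn
    obtain ⟨P, hP1, hP2, hP3⟩ := key n a fun x hx => by linarith [hb hx]
    exact ⟨P, hP1.trans inter_subset_left, hP2, fun x hx => hP3 x hx (ha hx)⟩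
  intro n
  induction n with
  | zero =>
    intro a ha
    refine ⟨∅, empty_subset _, pairwise_empty _, fun x hx hax => ?_⟩
    have := ha x hx
    simp at this
    linarith
  | succ n ih =>
    intro a ha
    by_cases hne : (F ∩ Ici a).Nonempty
    · obtain ⟨x₀, ⟨hx₀F, hx₀a⟩, hmin⟩ := (hF.inter_right isClosed_Ici).exists_isLeast hne
      obtain ⟨y, hyY, hy1, hy2⟩ := hY x₀ hx₀F
      have hay : a ≤ y := le_trans hx₀a hy1
      obtain ⟨P, hP1, hP2, hP3⟩ := ih (y + r) fun x hx => by
        have := ha x hx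
        push_cast at this
        linarith
      refine ⟨insert y P, ?_, ?_, ?_⟩
      · rintro p (rfl | hp)
        · exact ⟨hyY, hay⟩
        · refine ⟨(hP1 hp).1, ?_⟩
          have h1 : y + r ≤ p := (hP1 hp).2
          exact (show a ≤ p by linarith)
      · refine hP2.insert fun p hp _ => ?_
        have h1 : y + r ≤ p := (hP1 hp).2
        rw [dist_comm p y, Real.dist_eq, abs_sub_comm, abs_of_nonneg (by linarith)]
        exact ⟨by linarith, by linarith⟩
      · intro x hx hax
        rcases lt_or_ge x (y + r) with hxy | hxy
        · have h1 : x₀ ≤ x := hmin ⟨hx, hax⟩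
          exact ⟨y, mem_insert _ _, abs_lt.2 ⟨by linarith, by linarith⟩⟩
        · obtain ⟨p, hp, hxp⟩ := hP3 x hx hxy
          exact ⟨p, mem_insert_of_mem _ hp, hxp⟩
    · refine ⟨∅, empty_subset _, pairwise_empty _, fun x hx hax => ?_⟩
      exact absurd ⟨x, hx, hax⟩ hne

theorem maximal_isSeparatedSet {X : Type*} [MetricSpace X] {F P : Set X} {r : ℝ} (hP : P ⊆ F)
    (hs : IsSeparatedSet r P) (hc : ∀ x ∈ F, ∃ p ∈ P, dist x p < r) :
    Maximal (fun S : Set X => S ⊆ F ∧ IsSeparatedSet r S) P := by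
  refine ⟨⟨hP, hs⟩, fun S hS hPS x hx => ?_⟩
  obtain ⟨p, hp, hxp⟩ := hc x (hS.1 hx)
  by_cases h : x = p
  · exact h ▸ hp
  · exact absurd (hS.2 hx (hPS hp) h) (not_le.2 hxp)

open Classical in
/-- The code that agrees with `d` before `2k²`, leaves the main part at `2k²` at the latest, and
is the largest possible afterwards. -/
noncomputable def upperCode (G' : Set ℕ) (k : ℕ) (d : ℕ → Fin 2) (i : ℕ) : Fin 2 :=
  if i < 2 * k ^ 2 then d i
  else if i = 2 * k ^ 2 then (if ∃ j < k, d (2 * j ^ 2) = 1 then 0 else 1)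
  else if i ∈ G' then 1 else 0

theorem upperCode_of_lt {G' : Set ℕ} {k i : ℕ} (d : ℕ → Fin 2) (hi : i < 2 * k ^ 2) :
    upperCode G' k d i = d i := if_pos hi

theorem upperCode_self_eq_zero {G' : Set ℕ} {k : ℕ} {d : ℕ → Fin 2}
    (h : ∃ j < k, d (2 * j ^ 2) = 1) : upperCode G' k d (2 * k ^ 2) = 0 := by
  simp only [upperCode, lt_irrefl, if_false, if_true, if_pos h]

theorem upperCode_self_eq_one {G' : Set ℕ} {k : ℕ} {d : ℕ → Fin 2}
    (h : ¬ ∃ j < k, d (2 * j ^ 2) = 1) : upperCode G' k d (2 * k ^ 2) = 1 := by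
  simp only [upperCode, lt_irrefl, if_false, if_true, if_neg h]

theorem upperCode_of_gt_of_mem {G' : Set ℕ} {k i : ℕ} (d : ℕ → Fin 2) (hi : 2 * k ^ 2 < i)
    (hG : i ∈ G') : upperCode G' k d i = 1 := by
  simp only [upperCode, if_neg hi.not_gt, if_neg hi.ne', if_pos hG]

theorem upperCode_of_gt_of_notMem {G' : Set ℕ} {k i : ℕ} (d : ℕ → Fin 2) (hi : 2 * k ^ 2 < i)
    (hG : i ∉ G') : upperCode G' k d i = 0 := by
  simp only [upperCode, if_neg hi.not_gt, if_neg hi.ne', if_neg hG]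

theorem upperCode_congr_of_gt {G' : Set ℕ} {k i : ℕ} (d e : ℕ → Fin 2) (hi : 2 * k ^ 2 < i) :
    upperCode G' k d i = upperCode G' k e i := by
  simp only [upperCode, if_neg hi.not_gt, if_neg hi.ne']

theorem mem_of_upperCode_eq_one {G' : Set ℕ} {k i : ℕ} {d : ℕ → Fin 2} (hi : 2 * k ^ 2 < i)
    (h : upperCode G' k d i = 1) : i ∈ G' := by
  by_contra hG
  rw [upperCode_of_gt_of_notMem d hi hG] at h
  simp at h

theorem exists_upperCode_eq_one (G' : Set ℕ) (k : ℕ) (d : ℕ → Fin 2) :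
    ∃ j ≤ k, upperCode G' k d (2 * j ^ 2) = 1 := by
  by_cases h : ∃ j < k, d (2 * j ^ 2) = 1
  · obtain ⟨j, hj, hd⟩ := h
    exact ⟨j, hj.le, by rw [upperCode_of_lt d (by gcongr)]; exact hd⟩
  · exact ⟨k, le_rfl, upperCode_self_eq_one h⟩

/-- The candidates for abstract rationals at scale `2 ^ (-2k²)`. -/
def candidates (G' G : Set ℕ) (k : ℕ) : Set ℝ :=
  (fun d => Real.ofDigits (upperCode G' k d)) '' codeSet G' G

/-- The scale at which the abstract rationals with denominator `q` are chosen. -/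
noncomputable def scaleOf (q : ℕ) : ℕ :=
  sInf {k | q ≤ 2 ^ (2 * k ^ 2)}

theorem le_two_pow_scaleOf (q : ℕ) : q ≤ 2 ^ (2 * scaleOf q ^ 2) := by
  have : {k | q ≤ 2 ^ (2 * k ^ 2)}.Nonempty := by
    refine ⟨q, ?_⟩
    have h1 : q ≤ 2 * q ^ 2 := by nlinarith
    exact (Nat.lt_two_pow_self (n := q)).le.trans (Nat.pow_le_pow_right two_pos h1)
  exact Nat.sInf_mem this

theorem two_pow_lt_of_lt_scaleOf {q k : ℕ} (h : k < scaleOf q) : 2 ^ (2 * k ^ 2) < q :=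
  not_le.1 fun hle => absurd h (not_lt.2 (Nat.sInf_le hle))

theorem scaleOf_two_pow (k : ℕ) : scaleOf (2 ^ (2 * k ^ 2)) = k := by
  refine le_antisymm (Nat.sInf_le (by simp)) ?_
  have h := le_two_pow_scaleOf (2 ^ (2 * k ^ 2))
  rw [Nat.pow_le_pow_iff_right one_lt_two] at h
  have h2 : k ^ 2 ≤ scaleOf (2 ^ (2 * k ^ 2)) ^ 2 := by omega
  exact (Nat.pow_le_pow_iff_left two_ne_zero).1 h2

namespace IsBitPattern

variable {L H : ℝ} {G' G : Set ℕ}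

theorem upperCode_mem_codeSet (h : IsBitPattern L H G' G) {d : ℕ → Fin 2}
    (hd : d ∈ codeSet G' G) (k : ℕ) : upperCode G' k d ∈ codeSet G' G := by
  refine ⟨fun i hi => ?_, fun j hj i hji hi => ?_⟩
  · rcases lt_trichotomy i (2 * k ^ 2) with hik | hik | hik
    · rw [upperCode_of_lt d hik] at hi
      exact hd.1 i hi
    · exact Or.inr ⟨k, hik⟩
    · exact Or.inl (h.subset (mem_of_upperCode_eq_one hik hi))
  · rcases lt_trichotomy j k with hjk | rfl | hjk
    · rw [upperCode_of_lt d (by gcongr)] at hj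
      rcases lt_trichotomy i (2 * k ^ 2) with hik | rfl | hik
      · rw [upperCode_of_lt d hik] at hi
        exact hd.2 j hj i hji hi
      · rw [upperCode_self_eq_zero ⟨j, hjk, hj⟩] at hi
        simp at hi
      · exact mem_of_upperCode_eq_one hik hi
    · exact mem_of_upperCode_eq_one hji hi
    · exact absurd (mem_of_upperCode_eq_one (by gcongr) hj) (h.notMem' j)

/-- If `d` escapes at or before `2k²`, its digits are dominated one by one. Otherwise the first
difference is at `2k²`, where `d` has a zero, and the lexicographic order decides. -/
theorem ofDigits_le_upperCode (h : IsBitPattern L H G' G) {d : ℕ → Fin 2}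
    (hd : d ∈ codeSet G' G) (k : ℕ) : Real.ofDigits d ≤ Real.ofDigits (upperCode G' k d) := by
  by_cases hesc : ∃ j < k, d (2 * j ^ 2) = 1
  · refine ofDigits_mono fun i hi => ?_
    obtain ⟨j, hjk, hj⟩ := hesc
    have hjk' : 2 * j ^ 2 < 2 * k ^ 2 := by gcongr
    rcases lt_trichotomy i (2 * k ^ 2) with hik | rfl | hik
    · rwa [upperCode_of_lt d hik]
    · exact absurd (hd.2 j hj _ hjk' hi) (h.notMem' k)
    · exact upperCode_of_gt_of_mem d hik (hd.2 j hj i (hjk'.trans hik) hi)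
  · by_cases hk : d (2 * k ^ 2) = 1
    · refine ofDigits_mono fun i hi => ?_
      rcases lt_trichotomy i (2 * k ^ 2) with hik | rfl | hik
      · rwa [upperCode_of_lt d hik]
      · exact upperCode_self_eq_one hesc
      · exact upperCode_of_gt_of_mem d hik (hd.2 k hk i hik hi)
    · exact ofDigits_le_of_lex (i := 2 * k ^ 2) (fun j hj => (upperCode_of_lt d hj).symm)
        (fin_two_eq_zero hk) (upperCode_self_eq_one hesc)

/-- The forced zero at `2k² + 1` makes the inequality strict, as needed for maximality among
`1/q`-separated sets. -/
theorem upperCode_lt_add (h : IsBitPattern L H G' G) {d : ℕ → Fin 2}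
    (hd : d ∈ codeSet G' G) (k : ℕ) :
    Real.ofDigits (upperCode G' k d) < Real.ofDigits d + (1 / 2) ^ (2 * k ^ 2) := by
  have h1 := two_pow_mul_ofDigits d (2 * k ^ 2)
  have h2 := two_pow_mul_ofDigits (upperCode G' k d) (2 * k ^ 2)
  rw [prefixNat_congr fun i hi => upperCode_of_lt (G' := G') d hi] at h2
  have h3 := Real.ofDigits_nonneg (fun i => d (i + 2 * k ^ 2))
  have h4 : Real.ofDigits (fun i => upperCode G' k d (i + 2 * k ^ 2)) < 1 := by
    have h5 := two_pow_mul_ofDigits (fun i => upperCode G' k d (i + 2 * k ^ 2)) 1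
    have h6 : Real.ofDigits (fun i => upperCode G' k d (i + 1 + 2 * k ^ 2)) ≤ 1 / 2 := by
      refine ofDigits_le_half ?_
      rw [show 0 + 1 + 2 * k ^ 2 = 2 * k ^ 2 + 1 by ring]
      exact h.succ_eq_zero (h.upperCode_mem_codeSet hd k) k
    simp only [prefixNat] at h5
    have h7 : ((upperCode G' k d (0 + 2 * k ^ 2) : ℕ) : ℝ) ≤ 1 := by
      have := (upperCode G' k d (0 + 2 * k ^ 2)).isLt
      exact_mod_cast (by omega : (upperCode G' k d (0 + 2 * k ^ 2) : ℕ) ≤ 1)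
    push_cast at h5
    linarith
  have h8 : (0 : ℝ) < 2 ^ (2 * k ^ 2) := by positivity
  refine lt_of_mul_lt_mul_left ?_ h8.le
  rw [mul_add, h1, h2, one_div, inv_pow, mul_inv_cancel₀ h8.ne']
  linarith

theorem inv_natCast_ge {q : ℕ} (hq : 1 ≤ q) : (1 / 2 : ℝ) ^ (2 * scaleOf q ^ 2) ≤ 1 / q := by
  have h1 : (q : ℝ) ≤ 2 ^ (2 * scaleOf q ^ 2) := by exact_mod_cast le_two_pow_scaleOf q
  rw [one_div_pow]
  exact one_div_le_one_div_of_le (by exact_mod_cast hq) h1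

theorem exists_candidate_near (h : IsBitPattern L H G' G) {d : ℕ → Fin 2}
    (hd : d ∈ codeSet G' G) {q : ℕ} (hq : 1 ≤ q) :
    Real.ofDigits d ≤ Real.ofDigits (upperCode G' (scaleOf q) d) ∧
      Real.ofDigits (upperCode G' (scaleOf q) d) < Real.ofDigits d + 1 / q :=
  ⟨h.ofDigits_le_upperCode hd _,
    (h.upperCode_lt_add hd _).trans_le (add_le_add_right (inv_natCast_ge hq) _)⟩

theorem candidates_subset (h : IsBitPattern L H G' G) (k : ℕ) :
    candidates G' G k ⊆ pointSet G' G := by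
  rintro _ ⟨d, hd, rfl⟩
  exact ⟨_, h.upperCode_mem_codeSet hd k, rfl⟩

theorem exists_maximal_candidates (h : IsBitPattern L H G' G) {q : ℕ} (hq : 1 ≤ q) :
    ∃ P ⊆ candidates G' G (scaleOf q),
      Maximal (fun S : Set ℝ => S ⊆ pointSet G' G ∧ IsSeparatedSet (1 / (q : ℝ)) S) P := by
  obtain ⟨P, hP1, hP2, hP3⟩ := exists_separated_cover (isCompact_pointSet G' G)
    (Y := candidates G' G (scaleOf q)) (r := 1 / q) (by positivity) (by
      rintro _ ⟨d, hd, rfl⟩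
      exact ⟨_, ⟨d, hd, rfl⟩, h.exists_candidate_near hd hq⟩)
  exact ⟨P, hP1, maximal_isSeparatedSet (hP1.trans (h.candidates_subset _)) hP2
    fun x hx => by simpa only [Real.dist_eq] using hP3 x hx⟩

/-- At the scales `2 ^ (-2k²)` the right half of the set may use all its candidates. -/
theorem exists_maximal_candidates_superset (h : IsBitPattern L H G' G) {k : ℕ} (hk : 1 ≤ k) :
    ∃ P ⊆ candidates G' G k,
      Maximal (fun S : Set ℝ => S ⊆ pointSet G' G ∧
        IsSeparatedSet (1 / ((2 ^ (2 * k ^ 2) : ℕ) : ℝ)) S) P ∧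
      ∀ d ∈ codeSet G' G, d 0 = 1 → Real.ofDigits (upperCode G' k d) ∈ P := by
  set q : ℕ := 2 ^ (2 * k ^ 2) with hq
  have hq1 : 1 ≤ q := Nat.one_le_two_pow
  have hsc : scaleOf q = k := scaleOf_two_pow k
  have hk2 : 0 < 2 * k ^ 2 := by positivity
  have hup0 : ∀ d, upperCode G' k d 0 = d 0 := fun d => upperCode_of_lt d hk2
  have hq4 : (1 / (q : ℝ)) ≤ 1 / 4 := by
    refine one_div_le_one_div_of_le (by norm_num) ?_
    have : 2 ^ 2 ≤ 2 ^ (2 * k ^ 2) := Nat.pow_le_pow_right two_pos (by nlinarith)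
    exact_mod_cast this
  -- The left half, contained in `[0, 1/4]`, is treated greedily. It does not interact with the
  -- right half, which starts at `1/2`, because `1/q ≤ 1/4`.
  obtain ⟨P, hP1, hP2, hP3⟩ := exists_separated_cover
    ((isCompact_pointSet G' G).inter_right (isClosed_Iic (a := (1 / 4 : ℝ))))
    (Y := {x | ∃ d ∈ codeSet G' G, d 0 = 0 ∧ Real.ofDigits (upperCode G' k d) = x})
    (r := 1 / q) (by positivity) (by
      rintro _ ⟨⟨d, hd, rfl⟩, hx⟩
      have hd0 : d 0 = 0 := fin_two_eq_zero fun h1 => by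
        have := half_le_ofDigits h1
        have hx' : Real.ofDigits d ≤ 1 / 4 := hx
        linarith
      have := h.exists_candidate_near hd hq1
      rw [hsc] at this
      exact ⟨_, ⟨d, hd, hd0, rfl⟩, this⟩)
  set M : Set ℝ := {x | ∃ d ∈ codeSet G' G, d 0 = 1 ∧ Real.ofDigits (upperCode G' k d) = x} with hM
  have hPle : ∀ p ∈ P, p ≤ 1 / 4 := fun p hp => by
    obtain ⟨d, hd, hd0, rfl⟩ := hP1 hp
    exact h.ofDigits_le_quarter (h.upperCode_mem_codeSet hd k) (by rw [hup0, hd0])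
  have hMge : ∀ p ∈ M, 1 / 2 ≤ p := fun p hp => by
    obtain ⟨d, hd, hd0, rfl⟩ := hp
    exact half_le_ofDigits (by rw [hup0, hd0])
  have hsub : M ∪ P ⊆ candidates G' G k := by
    rintro x (⟨d, hd, -, rfl⟩ | hx)
    · exact ⟨d, hd, rfl⟩
    · obtain ⟨d, hd, -, rfl⟩ := hP1 hx
      exact ⟨d, hd, rfl⟩
  refine ⟨M ∪ P, hsub, maximal_isSeparatedSet (hsub.trans (h.candidates_subset k)) ?_ ?_,
    fun d hd hd0 => Or.inl ⟨d, hd, hd0, rfl⟩⟩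
  · rintro x (hx | hx) y (hy | hy) hne
    · obtain ⟨d, hd, hd0, rfl⟩ := hx
      obtain ⟨e, he, he0, rfl⟩ := hy
      -- Both codes escaped at `0 < 2k²`, so both have a zero at `2k²` and the same tail from there
      -- on.
      have := le_abs_ofDigits_sub_of_tail (n := 2 * k ^ 2) (fun i hi => ?_) hne
      · rw [Real.dist_eq]
        refine le_trans (le_of_eq ?_) this
        rw [hq, one_div_pow]; push_cast; rfl
      · rcases hi.eq_or_lt with rfl | hi
        · rw [upperCode_self_eq_zero ⟨0, by omega, by simpa using hd0⟩,
            upperCode_self_eq_zero ⟨0, by omega, by simpa using he0⟩]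
        · exact upperCode_congr_of_gt d e hi
    · have h1 := hMge x hx
      have h2 := hPle y hy
      rw [Real.dist_eq]
      exact le_trans (by linarith) (le_abs_self _)
    · have h1 := hMge y hy
      have h2 := hPle x hx
      rw [Real.dist_eq, abs_sub_comm]
      exact le_trans (by linarith) (le_abs_self _)
    · exact hP2 hx hy hne
  · rintro _ ⟨d, hd, rfl⟩
    by_cases hd0 : d 0 = 1
    · have h1 := h.exists_candidate_near hd hq1
      rw [hsc] at h1
      refine ⟨_, Or.inl ⟨d, hd, hd0, rfl⟩, ?_⟩
      rw [Real.dist_eq, abs_lt]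
      constructor <;> linarith
    · obtain ⟨p, hp, hxp⟩ := hP3 (Real.ofDigits d) ⟨⟨d, hd, rfl⟩,
        h.ofDigits_le_quarter hd (fin_two_eq_zero hd0)⟩
      exact ⟨p, Or.inr hp, by rwa [Real.dist_eq]⟩

/-- A choice of abstract rationals among the candidates, with many points on the right half. -/
theorem exists_isAbstractRationals (h : IsBitPattern L H G' G) :
    ∃ P : ℕ → Set ℝ, IsAbstractRationals (pointSet G' G) P ∧
      (∀ q, 1 ≤ q → P q ⊆ candidates G' G (scaleOf q)) ∧
      ∀ k, 1 ≤ k → ∀ d ∈ codeSet G' G, d 0 = 1 →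
        Real.ofDigits (upperCode G' k d) ∈ P (2 ^ (2 * k ^ 2)) := by
  have key : ∀ q : ℕ, ∃ P : Set ℝ, 1 ≤ q →
      (Maximal (fun S : Set ℝ => S ⊆ pointSet G' G ∧ IsSeparatedSet (1 / (q : ℝ)) S) P ∧
      P ⊆ candidates G' G (scaleOf q) ∧
      ∀ k, 1 ≤ k → q = 2 ^ (2 * k ^ 2) → ∀ d ∈ codeSet G' G, d 0 = 1 →
        Real.ofDigits (upperCode G' k d) ∈ P) := by
    intro q
    by_cases hq : ∃ k, 1 ≤ k ∧ q = 2 ^ (2 * k ^ 2)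
    · obtain ⟨k, hk, rfl⟩ := hq
      obtain ⟨P, hP1, hP2, hP3⟩ := h.exists_maximal_candidates_superset hk
      refine ⟨P, fun _ => ⟨hP2, by rwa [scaleOf_two_pow], fun k' _ hkk' => ?_⟩⟩
      have : k = k' := by rw [← scaleOf_two_pow k, hkk', scaleOf_two_pow]
      exact this ▸ hP3
    · by_cases hq1 : 1 ≤ q
      · obtain ⟨P, hP1, hP2⟩ := h.exists_maximal_candidates hq1
        exact ⟨P, fun _ => ⟨hP2, hP1, fun k hk hk' => absurd ⟨k, hk, hk'⟩ hq⟩⟩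
      · exact ⟨∅, fun h1 => absurd h1 hq1⟩
  choose P hP using key
  exact ⟨P, fun q hq => (hP q hq).1, fun q hq => (hP q hq).2.1,
    fun k hk d hd hd0 => (hP _ Nat.one_le_two_pow).2.2 k hk rfl d hd hd0⟩

end IsBitPattern

/-! ### The well approximable points: upper bound -/

namespace IsBitPattern

variable {L H : ℝ} {G' G : Set ℕ}

/-- The common zero directly after the escape position `2j²` separates codes that disagree there. -/
theorem le_abs_ofDigits_sub_of_escape (h : IsBitPattern L H G' G) {d e : ℕ → Fin 2}
    (hd : d ∈ codeSet G' G) (he : e ∈ codeSet G' G) {j k : ℕ} (hjk : j ≤ k)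
    (hne : d (2 * j ^ 2) ≠ e (2 * j ^ 2)) :
    (1 / 2) ^ (2 * k ^ 2 + 2) ≤ |Real.ofDigits d - Real.ofDigits e| :=
  le_trans (pow_le_pow_of_le_one (by norm_num) (by norm_num)
    (by have := Nat.pow_le_pow_left hjk 2; omega))
    (le_abs_ofDigits_sub_of_zero (Nat.lt_succ_self _) hne (h.succ_eq_zero hd j)
      (h.succ_eq_zero he j))

/-- Candidates of level `k + 1` serve every `q` with `2^(2k²) < q ≤ 2^(2(k+1)²)`, so only the lower
end bounds `q^(-t)`. This is the origin of the shift between `k + 1` and `k`. -/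
theorem frequently_of_mem_approxSet {P : ℕ → Set ℝ}
    (hP : ∀ q, 1 ≤ q → P q ⊆ candidates G' G (scaleOf q)) {t : ℝ} (ht : 0 < t) {x : ℝ}
    (hx : x ∈ approxSet (pointSet G' G) P t) :
    ∃ᶠ k : ℕ in atTop, ∃ e ∈ codeSet G' G,
      |Real.ofDigits (upperCode G' (k + 1) e) - x| ≤ 2 ^ (-(t * (2 * (k : ℝ) ^ 2))) := by
  refine frequently_atTop.2 fun K => ?_
  obtain ⟨q, hq, p, hp, hpx⟩ := hx.2 (2 ^ (2 * K ^ 2))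
  have hKs : K < scaleOf q := by
    by_contra! hle
    have h1 : 2 ^ (2 * scaleOf q ^ 2) ≤ 2 ^ (2 * K ^ 2) :=
      Nat.pow_le_pow_right two_pos (by gcongr)
    have := le_two_pow_scaleOf q
    omega
  obtain ⟨k, hk⟩ := Nat.exists_eq_succ_of_ne_zero (Nat.ne_of_gt (Nat.zero_lt_of_lt hKs))
  obtain ⟨e, he, rfl⟩ := hP q (Nat.one_le_of_lt hq) hp
  rw [hk, Nat.succ_eq_add_one] at hpx
  refine ⟨k, by omega, e, he, ?_⟩
  rw [← Real.dist_eq]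
  refine hpx.trans ?_
  have h1 : 2 ^ (2 * k ^ 2) < q := two_pow_lt_of_lt_scaleOf (by omega)
  have h2 : (2 : ℝ) ^ (2 * (k : ℝ) ^ 2) ≤ q := by
    have : (2 : ℝ) ^ (2 * k ^ 2) < q := by exact_mod_cast h1
    rw [← Real.rpow_natCast] at this
    push_cast at this
    exact_mod_cast this.le
  rw [Real.rpow_neg two_pos.le, mul_comm t, Real.rpow_mul two_pos.le, ← one_div]
  gcongr

/-- This is where `t > 1` enters: `t k²` eventually exceeds `(k + 1)² + 1`, so the approximation is
finer than the gaps one level up. -/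
theorem eventually_rpow_lt {t : ℝ} (ht : 1 < t) :
    ∀ᶠ k : ℕ in atTop, (2 : ℝ) ^ (-(t * (2 * (k : ℝ) ^ 2))) < (1 / 2) ^ (2 * (k + 1) ^ 2 + 2) := by
  obtain ⟨K, hK⟩ := exists_nat_gt (4 / (t - 1))
  filter_upwards [eventually_ge_atTop (K + 1)] with k hk
  rw [half_pow_eq_rpow]
  refine Real.rpow_lt_rpow_of_exponent_lt one_lt_two (neg_lt_neg ?_)
  have hk' : (K : ℝ) + 1 ≤ k := by exact_mod_cast hk
  have hK0 : (0 : ℝ) ≤ K := Nat.cast_nonneg K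
  have h1 : 4 < k * (t - 1) := by
    rw [div_lt_iff₀ (by linarith)] at hK
    nlinarith
  have h2 : 4 * (k : ℝ) < k * (t - 1) * k := by nlinarith
  push_cast
  nlinarith

/-- The points close to candidates on the part that leaves the main part at `2j²`. -/
def nearSet (G' G : Set ℕ) (t : ℝ) (j : ℕ) : Set ℝ :=
  {x | ∃ᶠ k : ℕ in atTop, j ≤ k ∧ ∃ e ∈ codeSet G' G, upperCode G' (k + 1) e (2 * j ^ 2) = 1 ∧
    |Real.ofDigits (upperCode G' (k + 1) e) - x| ≤ 2 ^ (-(t * (2 * (k : ℝ) ^ 2)))}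

/-- Every candidate has escaped, and an approximation finer than the gaps must have the same escape
digits. Hence a well approximable point escapes at some `2j²`, and its late approximants have a one
there too. -/
theorem approxSet_subset (h : IsBitPattern L H G' G) {P : ℕ → Set ℝ}
    (hP : ∀ q, 1 ≤ q → P q ⊆ candidates G' G (scaleOf q)) {t : ℝ} (ht : 1 < t) :
    approxSet (pointSet G' G) P t ⊆ ⋃ j, nearSet G' G t j := by
  intro x hx
  have hfreq := frequently_of_mem_approxSet hP (by linarith) hx
  obtain ⟨⟨d, hd, rfl⟩, -⟩ := hx
  obtain ⟨j, hj⟩ : ∃ j, d (2 * j ^ 2) = 1 := by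
    by_contra! hno
    obtain ⟨k, ⟨e, he, hke⟩, hk⟩ := (hfreq.and_eventually (eventually_rpow_lt ht)).exists
    obtain ⟨i, hik, hi⟩ := exists_upperCode_eq_one G' (k + 1) e
    have := h.le_abs_ofDigits_sub_of_escape (h.upperCode_mem_codeSet he (k + 1)) hd hik
      (by rw [hi]; exact (hno i).symm)
    linarith
  refine mem_iUnion.2 ⟨j, ?_⟩
  refine (hfreq.and_eventually ((eventually_rpow_lt ht).and (eventually_ge_atTop j))).mono ?_
  rintro k ⟨⟨e, he, hke⟩, hk, hjk⟩
  refine ⟨hjk, e, he, ?_, hke⟩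
  by_contra hne
  have := h.le_abs_ofDigits_sub_of_escape (h.upperCode_mem_codeSet he (k + 1)) hd
    (j := j) (k := k + 1) (by omega) (by rw [hj]; exact hne)
  linarith

/-- After an escape at `j < k` the digit at `2k²` must vanish, and the later digits of a candidate
do not depend on the code. So the prefix determines the candidate, which allows candidates to be
counted. -/
theorem upperCode_congr (h : IsBitPattern L H G' G) {d e : ℕ → Fin 2} (hd : d ∈ codeSet G' G)
    (he : e ∈ codeSet G' G) {j k : ℕ} (hjk : j < k) (hdj : upperCode G' k d (2 * j ^ 2) = 1)
    (hej : upperCode G' k e (2 * j ^ 2) = 1)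
    (hde : ∀ i < 2 * k ^ 2, upperCode G' k d i = upperCode G' k e i) :
    upperCode G' k d = upperCode G' k e := by
  have hjk' : 2 * j ^ 2 < 2 * k ^ 2 := by gcongr
  funext i
  rcases lt_trichotomy i (2 * k ^ 2) with hik | rfl | hik
  · exact hde i hik
  · have key : ∀ d ∈ codeSet G' G, upperCode G' k d (2 * j ^ 2) = 1 →
        upperCode G' k d (2 * k ^ 2) = 0 := fun d hd hdj =>
      fin_two_eq_zero fun h1 => h.notMem' k ((h.upperCode_mem_codeSet hd k).2 j hdj _ hjk' h1)
    rw [key d hd hdj, key e he hej]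
  · exact upperCode_congr_of_gt d e hik

/-- The covering sets at level `k` are indexed by the possible sets `w` of ones before `2(k+1)²`: up
to a constant at most `2^(2L(k+1)²)` of them, of diameter at most `2 · 2^(-2tk²)`. The `s`-sums
converge as soon as `s t > L`. -/
theorem dimH_nearSet_le (h : IsBitPattern L H G' G) {t : ℝ} (ht : 1 < t) (j : ℕ) :
    dimH (nearSet G' G t j) ≤ ENNReal.ofReal (L / t) := by
  refine le_of_forall_gt fun s' hs' => ?_
  obtain ⟨s, hs, hss'⟩ := ENNReal.lt_iff_exists_nnreal_btwn.1 hs'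
  refine lt_of_le_of_lt ?_ hss'
  have ht0 : 0 < t := by linarith
  have hη : 0 < s * t - L := by
    have : L / t < s := by
      by_contra h'
      rw [← ENNReal.ofReal_coe_nnreal] at hs
      exact absurd hs (not_lt.2 (ENNReal.ofReal_le_ofReal (not_lt.1 h')))
    rw [div_lt_iff₀ ht0] at this
    linarith
  set η : ℝ := s * t - L with hη_def
  set T : ℕ → Finset ℕ := fun k => Finset.range (2 * j ^ 2 + 1) ∪ bitsIn G' 0 (2 * (k + 1) ^ 2)
    with hT
  set ρ : ℕ → ℝ := fun k => 2 ^ (-(t * (2 * (k : ℝ) ^ 2))) with hρ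
  have hρ0 : ∀ k, 0 < ρ k := fun k => by positivity
  have hρle : ∀ k, ρ k ≤ (1 / 2) ^ k := fun k => by
    rw [half_pow_eq_rpow]
    refine Real.rpow_le_rpow_of_exponent_le one_le_two (neg_le_neg ?_)
    have h1 : (k : ℝ) ≤ k ^ 2 := by exact_mod_cast Nat.le_self_pow two_ne_zero k
    have h2 : (0 : ℝ) ≤ k := Nat.cast_nonneg k
    nlinarith
  refine dimH_le_of_frequently_mem (ι := fun k => {w // w ∈ (T k).powerset})
    (δ := fun k => ENNReal.ofReal (2 * ρ k))
    (t := fun k w => {x | j ≤ k ∧ ∃ e ∈ codeSet G' G, upperCode G' (k + 1) e (2 * j ^ 2) = 1 ∧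
      (T k).filter (fun i => upperCode G' (k + 1) e i = 1) = w ∧
      |Real.ofDigits (upperCode G' (k + 1) e) - x| ≤ ρ k}) ?_ ?_ ?_ ?_ ?_
  · refine antitone_nat_of_succ_le fun k => ENNReal.ofReal_le_ofReal ?_
    simp only [hρ]
    gcongr
    · norm_num
    · simp
  · rw [← ENNReal.ofReal_zero]
    refine (ENNReal.continuous_ofReal.tendsto 0).comp ?_
    refine squeeze_zero (fun k => by have := hρ0 k; positivity)
      (fun k => mul_le_mul_of_nonneg_left (hρle k) two_pos.le) ?_
    have := (tendsto_pow_atTop_nhds_zero_of_lt_one (r := (1 / 2 : ℝ)) (by norm_num)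
      (by norm_num)).const_mul 2
    rwa [mul_zero] at this
  · rintro k ⟨w, hw⟩
    refine Metric.ediam_le_of_forall_dist_le ?_
    rintro x ⟨hjk, d, hd, hdj, hdw, hdx⟩ y ⟨-, e, he, hej, hew, hey⟩
    have hmem : ∀ d ∈ codeSet G' G, upperCode G' (k + 1) d (2 * j ^ 2) = 1 →
        ∀ i < 2 * (k + 1) ^ 2, upperCode G' (k + 1) d i = 1 → i ∈ T k := by
      intro d hd hdj i hi hdi
      rw [hT, Finset.mem_union, Finset.mem_range, mem_bitsIn]
      rcases lt_or_ge (2 * j ^ 2) i with hij | hij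
      · exact Or.inr ⟨⟨Nat.zero_le _, hi⟩, (h.upperCode_mem_codeSet hd _).2 j hdj i hij hdi⟩
      · exact Or.inl (by omega)
    have hde := h.upperCode_congr hd he (Nat.lt_succ_of_le hjk) hdj hej
      (eq_of_filter_eq (hmem d hd hdj) (hmem e he hej) (hdw.trans hew.symm))
    rw [hde] at hdx
    rw [two_mul]
    refine (dist_triangle_left x y (Real.ofDigits (upperCode G' (k + 1) e))).trans
      (add_le_add ?_ ?_)
    · rwa [Real.dist_eq]
    · rwa [Real.dist_eq]
  -- The last term is the maximum of `(4L + 1)x - 2ηx²`. It absorbs the linear term from `(k+1)²`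
  -- and leaves a spare `-k`, which makes the series geometric.
  · set D : ℝ := 2 * j ^ 2 + 1 + s + 2 * L + (4 * L + 1) ^ 2 / (8 * η) with hD
    have hsum : Summable fun k : ℕ => (2 : ℝ) ^ D * (1 / 2) ^ k :=
      (summable_geometric_of_lt_one (by norm_num) (by norm_num)).mul_left _
    refine ne_top_of_le_ne_top hsum.tsum_ofReal_ne_top (ENNReal.tsum_le_tsum fun k => ?_)
    have hcard : ((T k).card : ℝ) ≤ 2 * j ^ 2 + 1 + L * (2 * (k + 1) ^ 2) := by
      have h1 := Finset.card_union_le (Finset.range (2 * j ^ 2 + 1))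
        (bitsIn G' 0 (2 * (k + 1) ^ 2))
      rw [Finset.card_range] at h1
      have h2 := h.card_le' (2 * (k + 1) ^ 2)
      have h3 : ((T k).card : ℝ) ≤ 2 * j ^ 2 + 1 + (bitsIn G' 0 (2 * (k + 1) ^ 2)).card := by
        exact_mod_cast h1
      push_cast at h2
      linarith
    have hexp : ((T k).card : ℝ) + (1 + -(t * (2 * (k : ℝ) ^ 2))) * s ≤ D - k := by
      have h1 : (4 * L + 1) * k - 2 * η * k ^ 2 ≤ (4 * L + 1) ^ 2 / (8 * η) := by
        rw [le_div_iff₀ (by positivity)]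
        nlinarith [sq_nonneg (4 * η * k - (4 * L + 1))]
      have h2 : (s : ℝ) * t = η + L := by rw [hη_def]; ring
      have h3 : (t * (2 * (k : ℝ) ^ 2)) * s = 2 * (η + L) * k ^ 2 := by rw [← h2]; ring
      rw [hD]
      linarith
    rw [Fintype.card_coe, Finset.card_powerset, ENNReal.ofReal_rpow_of_pos (by
      have := hρ0 k; positivity), ← ENNReal.ofReal_natCast, ← ENNReal.ofReal_mul (by positivity)]
    refine ENNReal.ofReal_le_ofReal ?_
    calc ((2 ^ (T k).card : ℕ) : ℝ) * (2 * ρ k) ^ (s : ℝ)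
        = 2 ^ (((T k).card : ℝ) + (1 + -(t * (2 * (k : ℝ) ^ 2))) * s) := by
          rw [Real.rpow_add two_pos, Real.rpow_natCast, Real.rpow_mul two_pos.le,
            Real.rpow_add two_pos, Real.rpow_one]
          push_cast
          rfl
      _ ≤ 2 ^ (D - k) := Real.rpow_le_rpow_of_exponent_le one_le_two hexp
      _ = 2 ^ D * (1 / 2) ^ k := by
          rw [half_pow_eq_rpow, ← Real.rpow_add two_pos, sub_eq_add_neg]
  · intro x hx
    refine hx.mono ?_
    rintro k ⟨hjk, e, he, hej, hex⟩
    exact ⟨⟨_, Finset.mem_powerset.2 (Finset.filter_subset _ _)⟩, hjk, e, he, hej, rfl, hex⟩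

theorem dimH_approxSet_le (h : IsBitPattern L H G' G) {P : ℕ → Set ℝ}
    (hP : ∀ q, 1 ≤ q → P q ⊆ candidates G' G (scaleOf q)) {t : ℝ} (ht : 1 < t) :
    dimH (approxSet (pointSet G' G) P t) ≤ ENNReal.ofReal (L / t) := by
  refine (dimH_mono (h.approxSet_subset hP ht)).trans ?_
  rw [dimH_iUnion]
  exact iSup_le fun j => h.dimH_nearSet_le ht j

end IsBitPattern

/-! ### The well approximable points: lower bound -/

/-- The positions of `G'` outside the windows `[m, t m)`, for `m = 2 (A ^ j) ^ 2`. -/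
def sparseBits (G' : Set ℕ) (A : ℕ) (t : ℝ) : Set ℕ :=
  {i | i ∈ G' ∧ ∀ j, ¬ (2 * (A ^ j) ^ 2 ≤ i ∧ i < ⌈t * (2 * ((A : ℝ) ^ j) ^ 2)⌉₊)}

/-- The sparse positions before a window. -/
theorem le_card_sparseBits_window {G' : Set ℕ} {A : ℕ} {t ε L' C₀ : ℝ} (hA : 2 ≤ A) (ht : 1 < t)
    (hε : 0 < ε) (hε1 : ε ≤ 1) (hAε : (t + 1) / ε ≤ A) (hL' : 0 ≤ L')
    (hC₀ : ∀ a b : ℕ, a ≤ b → L' * (b - a) - C₀ ≤ (bitsIn G' a b).card) (j : ℕ) :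
    L' * ((1 - ε) * (2 * ((A : ℝ) ^ j) ^ 2)) - L' - C₀ ≤
      (bitsIn (sparseBits G' A t) 0 (2 * (A ^ j) ^ 2)).card := by
  set m : ℕ := 2 * (A ^ j) ^ 2 with hm
  have hmr : (2 * ((A : ℝ) ^ j) ^ 2) = m := by rw [hm]; push_cast; rfl
  -- As `A` is large compared with `t / ε`, all earlier windows end before `εm`, so no position of
  -- `G'` in `[a, m)` is lost.
  set a : ℕ := ⌈ε * m⌉₊ with ha
  have ham : a ≤ m := by
    refine Nat.ceil_le.2 ?_
    have : (0 : ℝ) ≤ m := Nat.cast_nonneg m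
    nlinarith
  have ha1 : (a : ℝ) < ε * m + 1 := Nat.ceil_lt_add_one (by positivity)
  have hAr : (2 : ℝ) ≤ A := by exact_mod_cast hA
  have hAε' : t + 1 ≤ ε * A := by
    rw [div_le_iff₀ hε] at hAε; linarith
  have hsub : bitsIn G' a m ⊆ bitsIn (sparseBits G' A t) 0 m := by
    intro i hi
    obtain ⟨⟨h1, h2⟩, h3⟩ := mem_bitsIn.1 hi
    refine mem_bitsIn.2 ⟨⟨Nat.zero_le _, h2⟩, h3, fun l hl => ?_⟩
    have hlj : l < j := by
      by_contra! hjl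
      have : 2 * (A ^ j) ^ 2 ≤ 2 * (A ^ l) ^ 2 := by gcongr; omega
      omega
    refine absurd hl.2 (not_lt.2 (le_trans (Nat.ceil_le_ceil ?_) h1))
    have h4 : (A : ℝ) ^ (l + 1) ≤ A ^ j := pow_le_pow_right₀ (by linarith) hlj
    have h5 : (0 : ℝ) < A ^ l := by positivity
    have h6 : ((A : ℝ) ^ l * A) ^ 2 ≤ (A ^ j) ^ 2 := by rw [← pow_succ]; gcongr
    have h7 : t ≤ ε * A ^ 2 := by nlinarith
    rw [← hmr]
    calc t * (2 * ((A : ℝ) ^ l) ^ 2) ≤ ε * A ^ 2 * (2 * ((A : ℝ) ^ l) ^ 2) := by gcongr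
      _ = ε * (2 * ((A : ℝ) ^ l * A) ^ 2) := by ring
      _ ≤ ε * (2 * ((A : ℝ) ^ j) ^ 2) := by gcongr
  have h1 := hC₀ a m ham
  have h2 : ((bitsIn G' a m).card : ℝ) ≤ (bitsIn (sparseBits G' A t) 0 m).card := by
    exact_mod_cast Finset.card_le_card hsub
  rw [hmr]
  nlinarith

/-- The worst position is the end `tm` of a window, where about `L'(1 - ε)m` free positions have
been seen; `hsL` says that this is enough. Past the window, free positions accumulate at rate at
least `L' ≥ s'`. -/
theorem le_card_sparseBits {G' : Set ℕ} {A : ℕ} {t ε L' C₀ s' : ℝ} (hA : 2 ≤ A) (ht : 1 < t)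
    (hε : 0 < ε) (hε1 : ε ≤ 1) (hAε : (t + 1) / ε ≤ A) (hL' : 0 ≤ L') (hs' : 0 ≤ s')
    (hsL : s' * t ≤ L' * (1 - ε))
    (hC₀ : ∀ a b : ℕ, a ≤ b → L' * (b - a) - C₀ ≤ (bitsIn G' a b).card) :
    ∃ C : ℝ, ∀ i : ℕ, s' * i - C ≤ (bitsIn (sparseBits G' A t) 0 i).card := by
  have hC0 : 0 ≤ C₀ := by
    have := hC₀ 0 0 le_rfl
    rw [bitsIn_self] at this
    simpa using this
  have hsL' : s' ≤ L' := by nlinarith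
  refine ⟨2 * s' + L' + 2 * C₀, fun i => ?_⟩
  rcases Nat.lt_or_ge i 2 with hi | hi
  · have h1 : (i : ℝ) ≤ 2 := by exact_mod_cast hi.le
    have h2 : (0 : ℝ) ≤ (bitsIn (sparseBits G' A t) 0 i).card := Nat.cast_nonneg _
    nlinarith
  have hA2 : 1 < A ^ 2 := by nlinarith
  -- This is the index of the last window that starts at or before `i`.
  set j := Nat.log (A ^ 2) (i / 2) with hj
  have hj1 : (A ^ 2) ^ j ≤ i / 2 := Nat.pow_log_le_self _ (by omega)
  have hj2 : i / 2 < (A ^ 2) ^ (j + 1) := Nat.lt_pow_succ_log_self hA2 _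
  have hpow : ∀ l, (A ^ 2) ^ l = (A ^ l) ^ 2 := fun l => by rw [← pow_mul, ← pow_mul, mul_comm]
  rw [hpow] at hj1 hj2
  have hwin := le_card_sparseBits_window hA ht hε hε1 hAε hL' hC₀ j
  set m : ℕ := 2 * (A ^ j) ^ 2 with hm
  have hmr : (2 * ((A : ℝ) ^ j) ^ 2) = m := by rw [hm]; push_cast; rfl
  rw [hmr] at hwin
  have hmi : m ≤ i := by omega
  set b : ℕ := ⌈t * m⌉₊ with hb
  have hb1 : (b : ℝ) < t * m + 1 := Nat.ceil_lt_add_one (by positivity)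
  have hb2 : t * m ≤ b := Nat.le_ceil _
  have hm0 : (0 : ℝ) ≤ m := Nat.cast_nonneg m
  have hmb : m ≤ b := by
    have : (m : ℝ) ≤ b := by nlinarith
    exact_mod_cast this
  have hsm : s' * (t * m) ≤ L' * ((1 - ε) * m) := by nlinarith
  rcases le_total i b with hib | hbi
  · have h1 : ((bitsIn (sparseBits G' A t) 0 m).card : ℝ) ≤
        (bitsIn (sparseBits G' A t) 0 i).card := by
      exact_mod_cast Finset.card_le_card (bitsIn_mono Subset.rfl le_rfl hmi)
    have h2 : (i : ℝ) ≤ b := by exact_mod_cast hib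
    nlinarith
  · have hsub : bitsIn (sparseBits G' A t) 0 m ∪ bitsIn G' b i ⊆
        bitsIn (sparseBits G' A t) 0 i := by
      refine Finset.union_subset (bitsIn_mono Subset.rfl le_rfl hmi) fun n hn => ?_
      obtain ⟨⟨h1, h2⟩, h3⟩ := mem_bitsIn.1 hn
      refine mem_bitsIn.2 ⟨⟨Nat.zero_le _, h2⟩, h3, fun l hl => ?_⟩
      have hlj : l ≤ j := by
        by_contra! hjl
        have h4 : (A ^ (j + 1)) ^ 2 ≤ (A ^ l) ^ 2 := by gcongr <;> omega
        omega
      refine absurd hl.2 (not_lt.2 (le_trans (Nat.ceil_le_ceil ?_) h1))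
      rw [← hmr]
      have hAr : (1 : ℝ) ≤ A := by exact_mod_cast (by omega : 1 ≤ A)
      gcongr
    have hdisj : Disjoint (bitsIn (sparseBits G' A t) 0 m) (bitsIn G' b i) := by
      rw [Finset.disjoint_left]
      intro n h1 h2
      have := mem_bitsIn.1 h1
      have := mem_bitsIn.1 h2
      omega
    have h1 := Finset.card_le_card hsub
    rw [Finset.card_union_of_disjoint hdisj] at h1
    have h2 : ((bitsIn (sparseBits G' A t) 0 m).card : ℝ) + (bitsIn G' b i).card ≤
        (bitsIn (sparseBits G' A t) 0 i).card := by exact_mod_cast h1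
    have h3 := hC₀ b i hbi
    have h4 : (b : ℝ) ≤ i := by exact_mod_cast hbi
    have h5 : s' * ((i : ℝ) - b) ≤ L' * (i - b) :=
      mul_le_mul_of_nonneg_right hsL' (by linarith)
    have h6 : s' * b ≤ s' * (t * m + 1) := by gcongr
    linarith

namespace IsBitPattern

variable {L H : ℝ} {G' G : Set ℕ}

open Classical in
-- The code escapes at `0`, so its candidate at a window start `2k²` has a zero there and ones on
-- `G'` afterwards. The window forces exactly these digits, so the two agree up to `t · 2k²`, that
-- is, within `q^(-t)` for `q = 2^(2k²)`.
theorem mem_approxSet_of_sparseBits (h : IsBitPattern L H G' G) {P : ℕ → Set ℝ}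
    (hP : ∀ k, 1 ≤ k → ∀ d ∈ codeSet G' G, d 0 = 1 →
      Real.ofDigits (upperCode G' k d) ∈ P (2 ^ (2 * k ^ 2))) {A : ℕ} (hA : 2 ≤ A) {t : ℝ}
    {d : ℕ → Fin 2}
    (hd : ∀ i ∉ sparseBits G' A t, d i = if i = 0 ∨ i ∈ G' then 1 else 0) :
    Real.ofDigits d ∈ approxSet (pointSet G' G) P t := by
  have hone : ∀ i, d i = 1 → i = 0 ∨ i ∈ G' := fun i hi => by
    by_contra hno
    rw [hd i fun hs => hno (Or.inr hs.1), if_neg hno] at hi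
    simp at hi
  have h0G : 0 ∉ G' := by simpa using h.notMem' 0
  have hd0 : d 0 = 1 := by
    rw [hd 0 fun hs => h0G hs.1]; simp
  have hmem : d ∈ codeSet G' G := by
    refine ⟨fun i hi => ?_, fun k hk i hki hi => ?_⟩
    · rcases hone i hi with rfl | h1
      · exact Or.inr ⟨0, rfl⟩
      · exact Or.inl (h.subset h1)
    · exact (hone i hi).resolve_left (by omega)
  refine ⟨⟨d, hmem, rfl⟩, fun N => ?_⟩
  have hAj : N < A ^ N := Nat.lt_pow_self (by omega)
  set k := A ^ N with hk
  have hNk : N < 2 ^ (2 * k ^ 2) := by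
    have h1 : k ≤ 2 * k ^ 2 := by nlinarith
    exact hAj.trans (Nat.lt_two_pow_self.trans_le (Nat.pow_le_pow_right two_pos h1))
  refine ⟨2 ^ (2 * k ^ 2), hNk, _, hP k (by omega) d hmem hd0, ?_⟩
  set b : ℕ := ⌈t * (2 * ((A : ℝ) ^ N) ^ 2)⌉₊ with hb
  have hagree : ∀ i < b, upperCode G' k d i = d i := by
    intro i hi
    rcases lt_trichotomy i (2 * k ^ 2) with hik | rfl | hik
    · exact upperCode_of_lt d hik
    · rw [upperCode_self_eq_zero ⟨0, by omega, by simpa using hd0⟩]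
      refine (fin_two_eq_zero fun h1 => ?_).symm
      rcases hone _ h1 with h2 | h2
      · have : 0 < 2 * k ^ 2 := by
          have : 0 < k := by omega
          positivity
        omega
      · exact h.notMem' k h2
    · rw [hd i fun hs => hs.2 N ⟨hik.le, hi⟩]
      by_cases hiG : i ∈ G'
      · rw [upperCode_of_gt_of_mem d hik hiG, if_pos (Or.inr hiG)]
      · rw [upperCode_of_gt_of_notMem d hik hiG, if_neg]
        rintro (h1 | h1)
        · omega
        · exact hiG h1
  rw [Real.dist_eq]
  refine (abs_ofDigits_sub_le hagree).trans ?_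
  have hbt : t * (2 * (k : ℝ) ^ 2) ≤ b := by
    rw [hk, hb]; push_cast; exact Nat.le_ceil _
  rw [half_pow_eq_rpow, one_div, ← Real.rpow_neg (by positivity), Nat.cast_pow, Nat.cast_ofNat,
    ← Real.rpow_natCast, ← Real.rpow_mul two_pos.le]
  refine Real.rpow_le_rpow_of_exponent_le one_le_two ?_
  push_cast
  linarith

theorem le_dimH_approxSet (h : IsBitPattern L H G' G) (hL1 : L ≤ 1) {P : ℕ → Set ℝ}
    (hP : ∀ k, 1 ≤ k → ∀ d ∈ codeSet G' G, d 0 = 1 →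
      Real.ofDigits (upperCode G' k d) ∈ P (2 ^ (2 * k ^ 2))) {t : ℝ} (ht : 1 < t) :
    ENNReal.ofReal (L / t) ≤ dimH (approxSet (pointSet G' G) P t) := by
  classical
  refine ENNReal.le_of_forall_nnreal_lt fun s hs => ?_
  rcases eq_or_ne s 0 with rfl | hs0
  · simp
  have hs0' : (0 : ℝ) < s := by positivity
  have ht0 : 0 < t := by linarith
  have hsL : (s : ℝ) < L / t := by
    by_contra h'
    rw [← ENNReal.ofReal_coe_nnreal] at hs
    exact absurd hs (not_lt.2 (ENNReal.ofReal_le_ofReal (not_lt.1 h')))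
  obtain ⟨s', hss', hs'L⟩ := exists_between hsL
  rw [lt_div_iff₀ ht0] at hs'L
  have hs'0 : 0 < s' := hs0'.trans hss'
  have hs't : 0 < s' * t := by positivity
  -- One `ε` is spent on the density of `G'` and one on earlier windows: `(L - ε)(1 - ε) ≥ L - 2ε =
  -- s' t`, because `L ≤ 1`.
  set ε : ℝ := (L - s' * t) / 2 with hε
  have hε0 : 0 < ε := by rw [hε]; linarith
  have hε1 : ε ≤ 1 := by rw [hε]; linarith
  have hLε : s' * t = L - 2 * ε := by rw [hε]; ring
  obtain ⟨C₀, hC₀⟩ := h.le_card' ε hε0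
  obtain ⟨A, hA⟩ := exists_nat_ge (max 2 ((t + 1) / ε))
  have hA2 : 2 ≤ A := by
    have := (le_max_left _ _).trans hA
    exact_mod_cast this
  obtain ⟨C, hC⟩ := le_card_sparseBits (G' := G') (s' := s') hA2 ht hε0 hε1
    ((le_max_right _ _).trans hA) (L' := L - ε) (by linarith) hs'0.le (by nlinarith) hC₀
  rw [← ENNReal.ofReal_coe_nnreal]
  refine le_dimH_of_free_bits (T := sparseBits G' A t)
    (d₀ := fun i => if i = 0 ∨ i ∈ G' then 1 else 0) hs0' hss'
    (fun k hk => h.succ_notMem' k hk.1) (fun k => ?_)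
    (fun d hd => h.mem_approxSet_of_sparseBits hP hA2 hd) hC
  rw [if_neg]
  rintro (h1 | h1)
  · omega
  · exact h.succ_notMem' k h1

end IsBitPattern

theorem mainTheorem8 (L H : ℝ) (hL : 0 ≤ L) (hLH : L ≤ H) (hH : H ≤ 1) :
    ∃ F : Set ℝ, F ⊆ Set.Icc 0 1 ∧ F.Nonempty ∧ IsCompact F ∧
      lowerDim F = ENNReal.ofReal L ∧
      dimH F = ENNReal.ofReal H ∧
      packingDim F = ENNReal.ofReal H ∧
      ∃ P : ℕ → Set ℝ, IsAbstractRationals F P ∧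
        ∀ t : ℝ, 1 < t →
          dimH (approxSet F P t) = ENNReal.ofReal (L / t) ∧
          dimH (approxSet F P t) = lowerDim F / ENNReal.ofReal t := by
  obtain ⟨G', G, h⟩ := exists_isBitPattern hL hLH hH
  obtain ⟨P, hP, hP1, hP2⟩ := h.exists_isAbstractRationals
  refine ⟨pointSet G' G, pointSet_subset_Icc G' G, ⟨0, IsBitPattern.zero_mem_pointSet⟩,
    isCompact_pointSet G' G, h.lowerDim_pointSet, h.dimH_pointSet hL hLH,
    h.packingDim_pointSet hL hLH, P, hP, fun t ht => ?_⟩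
  have key : dimH (approxSet (pointSet G' G) P t) = ENNReal.ofReal (L / t) :=
    le_antisymm (h.dimH_approxSet_le hP1 ht) (h.le_dimH_approxSet (hLH.trans hH) hP2 ht)
  refine ⟨key, ?_⟩
  rw [key, h.lowerDim_pointSet, ENNReal.ofReal_div_of_pos (by linarith)]
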